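/- **Setting.** Let $M\subset\mathbb{R}^D$ be a smooth embedded submanifold with the induced metric, and let $g:M\to\mathbb{R}^n$ and $h:M\to\mathbb{R}$ be $C^2$. Gradients of functions on $M$ are taken along $M$. Write $G=(g,h):M\to\mathbb{R}^{n+1}$ and assume: - $G$ is regular: its Jacobian has rank $n+1$ at every point of $M$. - $G$ is commuting: for all $i,j$ the Lie bracket $[\nabla G_i,\nabla G_j]=\partial(\nabla G_j)\nabla G_i-\partial(\nabla G_i)\nabla G_j$ vanishes on $M$. - Let $\phi^t_{G_i}(w)$ denote the solution at time $t$ of $\dot z=-\nabla G_i(z)$, $z(0)=w$. For all $w\in M$ and all $i$ it is defined on an interval $(T_-,T_+)\ni 0$, and $\|\phi^t_{G_i}(w)\|\to\infty$ at each finite endpoint. For $i\ne j$ and $s,t\in\mathbb{R}$, $\phi^s_{G_i}\circ\phi^t_{G_j}(w)$ is defined if and only if $\phi^t_{G_j}\circ\phi^s_{G_i}(w)$ is. Let $w_{\rm init}\in M$, let $f\in C^1(\mathbb{R}^n,\mathbb{R})$, let $\alpha:[0,\infty)\to\mathbb{R}$ be locally integrable, and put $a_t=-\int_0^t\alpha_s\,ds$.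 Let $(w_t)_{t\ge 0}$ be a solution in $M$ (in integrated form) of $$dw_t=-\big(\nabla_w f(g(w_t))+\alpha_t\nabla_w h(w_t)\big)dt,\qquad w_0=w_{\rm init},$$ and put $x_t=g(w_t)$. **Functions with values in $\mathbb{R}\cup\{\infty\}$.** Let $R:\mathbb{R}^n\to\mathbb{R}\cup\{\infty\}$ and $\operatorname{dom}R=\{R<\infty\}$. - $R$ is *Legendre* if it is convex, differentiable and strictly convex on $\operatorname{int}\operatorname{dom}R$, and $\|\nabla R(x_i)\|^2\to\infty$ for every sequence $x_i\in\operatorname{int}\operatorname{dom}R$ that converges to a boundary point of $\operatorname{dom}R$. - $R$ is *Bregman* if $\operatorname{dom}R$ is closed; $R$ is strictly convex and continuous on $\operatorname{dom}R$ and $C^1$ on $\operatorname{int}\operatorname{dom}R$; and, with $D_R(x,y)=R(x)-R(y)-\nabla R(y)^T(x-y)$, for every $x\in\operatorname{dom}R$ all sets $\{y\in\operatorname{int}\operatorname{dom}R: D_R(x,y)\le\gamma\}$, $\gamma\in\mathbb{R}$, are bounded, and $D_R(x,x_i)\to0$ whenever $\operatorname{int}\operatorname{dom}R\ni x_i\to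 x$. - A family $(R_a)_{a\in A}$, $A\subset\mathbb{R}$, is *contracting* if $dR_a/da\le0$ on $A$: $\operatorname{dom}R_{a_1}\subset\operatorname{dom}R_{a_2}$ for $a_1\le a_2$, and, where finite, $a\mapsto R_a(x)$ is differentiable with nonpositive derivative. **The time-dependent Legendre function.** Let $b<0$, and let $(R_a)_{a\in[b,0]}$ be the time-dependent Legendre function of $(g,h,w_{\rm init})$. That is, every $R_a$ is Legendre, and whenever a finite composition of the flows of the fields $\nabla g_1,\dots,\nabla g_n,\nabla h$, with total flow times $\mu_1,\dots,\mu_n$ and $a\in[b,0]$, is defined at $w_{\rm init}$ and leads to $w$, one has $g(w)\in\operatorname{int}\operatorname{dom}R_a$ and $\nabla R_a(g(w))=\mu$. (It depends neither on $f$ nor on $\alpha$.) **Theorem.** Assume that $\alpha_t\ge0$ for all $t\ge 0$, that $\alpha_t=0$ for all $t\ge T$, for some $T>0$, and that $a_t\ge b$ for all $t\ge0$. Put $a_\infty=\lim_{t\to\infty}a_t$. Assume that every $R_a$, $a\in[b,0]$, is a Bregman function and that $(R_a)_{a\in[b,0]}$ is contracting. Assume that $\nabla f$ is locally Lipschitz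 and that $f$ has a minimizer on $\operatorname{dom}R_{a_\infty}$. 1. If $f$ is quasi-convex, then $x_t$ converges as $t\to\infty$ to a point $x_*\in\operatorname{dom}R_{a_\infty}$ with $\nabla f(x_*)^T(x-x_*)\ge0$ for all $x\in\operatorname{dom}R_{a_\infty}$. 2. If $f$ is convex, then $x_t$ converges to a minimizer of $f$ over $\overline{\operatorname{dom}R_{a_\infty}}$. -/

import Mathlib

open Set Filter Topology MeasureTheory
open scoped ContDiff

noncomputable section

/-! ## Submanifolds of Euclidean space and gradients on them -/

/-- `M` is a smooth (embedded) submanifold of `ℝ^D`: around each of its points, a smooth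
diffeomorphism between open sets straightens `M` to a linear subspace of fixed dimension. -/
def IsSmoothSubmanifold {D : ℕ} (M : Set (EuclideanSpace ℝ (Fin D))) : Prop :=
  ∃ m : ℕ, ∀ w ∈ M,
    ∃ (Φ : OpenPartialHomeomorph (EuclideanSpace ℝ (Fin D)) (EuclideanSpace ℝ (Fin D)))
      (V : Submodule ℝ (EuclideanSpace ℝ (Fin D))),
      w ∈ Φ.source ∧ ContDiffOn ℝ ∞ Φ Φ.source ∧ ContDiffOn ℝ ∞ Φ.symm Φ.target ∧
      Module.finrank ℝ V = m ∧ ∀ z ∈ Φ.source, z ∈ M ↔ Φ z ∈ V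

/-- The tangent space of `M` at `w`, as a subspace of `ℝ^D`. -/
def tangentSpaceAt {D : ℕ} (M : Set (EuclideanSpace ℝ (Fin D)))
    (w : EuclideanSpace ℝ (Fin D)) : Submodule ℝ (EuclideanSpace ℝ (Fin D)) :=
  Submodule.span ℝ (tangentConeAt ℝ M w)

/-- The gradient at `w` of a function on the submanifold `M`, for the metric induced by `ℝ^D`.
A derivative within `M` is determined on tangent vectors only; projecting it
to the tangent space gives the one tangent vector that represents it. -/
def gradOn {D : ℕ} (M : Set (EuclideanSpace ℝ (Fin D))) (φ : EuclideanSpace ℝ (Fin D) → ℝ)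
    (w : EuclideanSpace ℝ (Fin D)) : EuclideanSpace ℝ (Fin D) :=
  (tangentSpaceAt M w).starProjection (gradientWithin φ M w)

/-! ## The parameterization -/

/-- The components of `(g, h) : M → ℝ^(n+1)`; the index `none` stands for `h`. -/
def jointComponents {D n : ℕ} (g : EuclideanSpace ℝ (Fin D) → EuclideanSpace ℝ (Fin n))
    (h : EuclideanSpace ℝ (Fin D) → ℝ) : Option (Fin n) → EuclideanSpace ℝ (Fin D) → ℝ
  | some i => fun w => g w i
  | none => h

/-- The Jacobian, whose rows are the gradients of the components, has full row rank on `M`. -/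
def IsRegularParam {D : ℕ} {ι : Type} (M : Set (EuclideanSpace ℝ (Fin D)))
    (G : ι → EuclideanSpace ℝ (Fin D) → ℝ) : Prop :=
  ∀ w ∈ M, LinearIndependent ℝ (fun i => gradOn M (G i) w)

/-- The gradient fields of the components have vanishing Lie brackets on `M`. -/
def IsCommutingParam {D : ℕ} {ι : Type} (M : Set (EuclideanSpace ℝ (Fin D)))
    (G : ι → EuclideanSpace ℝ (Fin D) → ℝ) : Prop :=
  ∀ i j, ∀ w ∈ M, VectorField.lieBracketWithin ℝ (gradOn M (G i)) (gradOn M (G j)) M w = 0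

/-- The gradient descent flow of `φ` on `M` is defined up to the (possibly negative) time `t` when
started in `w`, and is in `z` at that time. -/
def GradFlowTo {D : ℕ} (M : Set (EuclideanSpace ℝ (Fin D))) (φ : EuclideanSpace ℝ (Fin D) → ℝ)
    (t : ℝ) (w z : EuclideanSpace ℝ (Fin D)) : Prop :=
  ∃ γ : ℝ → EuclideanSpace ℝ (Fin D), γ 0 = w ∧ γ t = z ∧
    ∀ s ∈ uIcc 0 t, γ s ∈ M ∧ HasDerivWithinAt γ (-gradOn M φ (γ s)) (uIcc 0 t) s

/-- The gradient flow of every component lives on an open time interval `(T₋, T₊)` around `0`, at a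
finite end of which it blows up in norm, and for two different components the composition of
their flows in one order is defined if and only if that in the other order is. -/
def FlowsWellDefined {D : ℕ} {ι : Type} (M : Set (EuclideanSpace ℝ (Fin D)))
    (G : ι → EuclideanSpace ℝ (Fin D) → ℝ) : Prop :=
  (∀ w ∈ M, ∀ i, ∃ (Tm Tp : EReal) (γ : ℝ → EuclideanSpace ℝ (Fin D)),
    Tm < 0 ∧ 0 < Tp ∧ γ 0 = w ∧
    (∀ t : ℝ, Tm < t → t < Tp → γ t ∈ M ∧ HasDerivAt γ (-gradOn M (G i) (γ t)) t) ∧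
    (Tp = ⊤ ∨ ∃ τ : ℝ, Tp = τ ∧ Tendsto (fun t => ‖γ t‖) (𝓝[<] τ) atTop) ∧
    (Tm = ⊥ ∨ ∃ τ : ℝ, Tm = τ ∧ Tendsto (fun t => ‖γ t‖) (𝓝[>] τ) atTop)) ∧
  (∀ w ∈ M, ∀ i j, i ≠ j → ∀ s t : ℝ,
    (∃ z z', GradFlowTo M (G j) t w z ∧ GradFlowTo M (G i) s z z') ↔
    (∃ z z', GradFlowTo M (G i) s w z ∧ GradFlowTo M (G j) t z z'))

/-- `Reachable M G w₀ c w`: a finite composition of gradient flows of components of `G` leads from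
`w₀` to `w`, and `c i` is the total time that it spends flowing along `+∇ G i` (so that running
the descent flow of `G i` for time `t` changes `c i` by `-t`). -/
inductive Reachable {D : ℕ} {ι : Type} [DecidableEq ι] (M : Set (EuclideanSpace ℝ (Fin D)))
    (G : ι → EuclideanSpace ℝ (Fin D) → ℝ) (w₀ : EuclideanSpace ℝ (Fin D)) :
    (ι → ℝ) → EuclideanSpace ℝ (Fin D) → Prop
  | start : Reachable M G w₀ 0 w₀
  | step {c : ι → ℝ} {w z : EuclideanSpace ℝ (Fin D)} (i : ι) (t : ℝ) :
      Reachable M G w₀ c w → GradFlowTo M (G i) t w z →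
      Reachable M G w₀ (c - Pi.single i t) z

/-! ## Legendre and Bregman functions with values in `ℝ ∪ {∞}` -/

/-- The effective domain. -/
def effDom {n : ℕ} (R : EuclideanSpace ℝ (Fin n) → WithTop ℝ) : Set (EuclideanSpace ℝ (Fin n)) :=
  {x | R x ≠ ⊤}

/-- The real values of `R` on its effective domain (and `0` elsewhere). -/
def finVal {n : ℕ} (R : EuclideanSpace ℝ (Fin n) → WithTop ℝ) (x : EuclideanSpace ℝ (Fin n)) : ℝ :=
  (R x).untopD 0

/-- The gradient of `R`, meaningful on the interior of its effective domain. -/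
def gradFin {n : ℕ} (R : EuclideanSpace ℝ (Fin n) → WithTop ℝ) (x : EuclideanSpace ℝ (Fin n)) :
    EuclideanSpace ℝ (Fin n) :=
  gradient (finVal R) x

structure IsLegendre {n : ℕ} (R : EuclideanSpace ℝ (Fin n) → WithTop ℝ) : Prop where
  convex : ConvexOn ℝ (effDom R) (finVal R)
  differentiable : ∀ x ∈ interior (effDom R), DifferentiableAt ℝ (finVal R) x
  strictConvex : StrictConvexOn ℝ (interior (effDom R)) (finVal R)
  steep : ∀ (u : ℕ → EuclideanSpace ℝ (Fin n)) (x : EuclideanSpace ℝ (Fin n)),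
    (∀ i, u i ∈ interior (effDom R)) → x ∈ frontier (effDom R) → Tendsto u atTop (𝓝 x) →
    Tendsto (fun i => ‖gradFin R (u i)‖ ^ 2) atTop atTop

/-- The Bregman divergence `D_R(x, y)`, for `x` in the domain of `R` and `y` in its interior. -/
def bregmanDiv {n : ℕ} (R : EuclideanSpace ℝ (Fin n) → WithTop ℝ)
    (x y : EuclideanSpace ℝ (Fin n)) : ℝ :=
  finVal R x - finVal R y - inner ℝ (gradFin R y) (x - y)

structure IsBregman {n : ℕ} (R : EuclideanSpace ℝ (Fin n) → WithTop ℝ) : Prop where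
  isClosed_dom : IsClosed (effDom R)
  strictConvex : StrictConvexOn ℝ (effDom R) (finVal R)
  continuousOn : ContinuousOn (finVal R) (effDom R)
  contDiffOn : ContDiffOn ℝ 1 (finVal R) (interior (effDom R))
  bounded_sublevel : ∀ x ∈ effDom R, ∀ γ : ℝ,
    Bornology.IsBounded {y ∈ interior (effDom R) | bregmanDiv R x y ≤ γ}
  tendsto_div : ∀ x ∈ effDom R, ∀ u : ℕ → EuclideanSpace ℝ (Fin n),
    (∀ i, u i ∈ interior (effDom R)) → Tendsto u atTop (𝓝 x) →
    Tendsto (fun i => bregmanDiv R x (u i)) atTop (𝓝 0)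

/-- `dR_a/da ≤ 0` on the parameter set `A`. Where the values are finite the derivative exists and is
nonpositive; moreover a finite value does not become infinite as `a` increases. -/
def IsContracting {n : ℕ} (R : ℝ → EuclideanSpace ℝ (Fin n) → WithTop ℝ) (A : Set ℝ) : Prop :=
  (∀ a₁ ∈ A, ∀ a₂ ∈ A, a₁ ≤ a₂ → effDom (R a₁) ⊆ effDom (R a₂)) ∧
  ∀ a ∈ A, ∀ x ∈ effDom (R a), ∃ d ≤ 0,
    HasDerivWithinAt (fun a' => finVal (R a') x) d (A ∩ {a' | x ∈ effDom (R a')}) a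

/-! ## The regularized gradient flow and its time-dependent Legendre function -/

/-- `R a`, for `a ∈ A`, is the time-dependent Legendre function of the parameterization `g` with
regularization `h` and initialization `w₀`: every `R a` is Legendre, and if total times `μ` along
the gradient fields of `g` and `a` along that of `h` lead from `w₀` to `w`, then
`∇ (R a) (g w) = μ`. Neither the loss nor the regularization schedule enters. -/
def IsTimeDepLegendreOf {D n : ℕ} (M : Set (EuclideanSpace ℝ (Fin D)))
    (g : EuclideanSpace ℝ (Fin D) → EuclideanSpace ℝ (Fin n))
    (h : EuclideanSpace ℝ (Fin D) → ℝ) (w₀ : EuclideanSpace ℝ (Fin D)) (A : Set ℝ)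
    (R : ℝ → EuclideanSpace ℝ (Fin n) → WithTop ℝ) : Prop :=
  (∀ a ∈ A, IsLegendre (R a)) ∧
  ∀ (c : Option (Fin n) → ℝ) (w : EuclideanSpace ℝ (Fin D)),
    Reachable M (jointComponents g h) w₀ c w → c none ∈ A →
    g w ∈ interior (effDom (R (c none))) ∧
    gradFin (R (c none)) (g w) = WithLp.toLp 2 (fun i => c (some i))

/-- `w` solves `dw_t = -(∇_w f(g(w_t)) + α_t ∇_w h(w_t)) dt`, `w_0 = w₀`, on `[0, ∞)` in `M`. The
equation is integrated, so that `α` may jump. -/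
def IsRegularizedGradientFlow {D n : ℕ} (M : Set (EuclideanSpace ℝ (Fin D)))
    (g : EuclideanSpace ℝ (Fin D) → EuclideanSpace ℝ (Fin n))
    (h : EuclideanSpace ℝ (Fin D) → ℝ) (f : EuclideanSpace ℝ (Fin n) → ℝ) (α : ℝ → ℝ)
    (w₀ : EuclideanSpace ℝ (Fin D)) (w : ℝ → EuclideanSpace ℝ (Fin D)) : Prop :=
  ContinuousOn w (Ici 0) ∧ (∀ t, 0 ≤ t → w t ∈ M) ∧
  ∀ t, 0 ≤ t →
    w t = w₀ - ∫ s in (0 : ℝ)..t, (gradOn M (f ∘ g) (w s) + α s • gradOn M h (w s))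

/-- `a_t = -∫₀ᵗ α_s ds`. -/
def accumReg (α : ℝ → ℝ) (t : ℝ) : ℝ := -∫ s in (0 : ℝ)..t, α s

end

/-! For t ≥ T the schedule is off and a_t stays at a_∞. There x_t = g(w_t) is a mirror flow of the
single function R = R_{a_∞}: ∇R(x_t) = μ_t with μ_t' = -∇f(x_t). Convergence is then a Lyapunov
argument (`mirrorFlow_tendsto`). If f(y) ≤ f(x_t), quasi-convexity gives d/dt D_R(y, x_t) =
⟨∇f(x_t), y - x_t⟩ ≤ 0. Taking a minimizer for y bounds the trajectory, so there is a cluster point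
x_*, and it lies in the closed domain. Since the loss decreases along the gradient flow, x_* is
itself an admissible y: D_R(x_*, x_t) decreases and tends to 0 along a subsequence, hence
altogether, and this forces x_t → x_* (`IsBregman.eq_of_tendsto`). Now μ_t / t → -∇f(x_*), so a
feasible descent direction y - x_* would make the lower bound R(x_t) + ⟨μ_t, y - x_t⟩ of R(y)
diverge. For convex f, stationarity is minimality.

Most of the work is the identity ∇R(x_t) = μ_t. The defining property of R concerns finite
compositions of flows of single fields, whereas w_t moves along all fields at once, with controls
that are merely integrable. In local coordinates of M the vanishing brackets give the integrability
condition of DΨ = Z ∘ Ψ, where Z(w) c = ∑ c_i ∇G_i(w), and Frobenius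
(`exists_hasFDerivAt_of_integrable`) provides a joint flow Ψ
(`IsSmoothSubmanifold.exists_jointFlow`). The trajectory obeys dw = Z(w) dc, where c accumulates the
flow times, and such a curve coincides near t₀ with Ψ(c_t - c_{t₀}) (`IsDriven.eventually_eq`).
Points of Ψ are joined by moves along the coordinate axes, which are flows of single fields
(`Reachable.of_jointFlow`). Hence the times at which w_t is reachable with flow times c_t form an
open and closed set (`IsDriven.reachable`). -/

/-! ## First-order inequalities -/

/-- A chord bound on `(0, 1]` bounds the derivative at `0`. -/
theorem deriv_le_of_chord_le {φ : ℝ → ℝ} {d k : ℝ} (hφ : HasDerivAt φ d 0)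
    (h : ∀ s ∈ Ioc (0 : ℝ) 1, φ s ≤ φ 0 + s * k) : d ≤ k := by
  have ht : Tendsto (slope φ 0) (𝓝[>] 0) (𝓝 d) :=
    (hasDerivAt_iff_tendsto_slope.1 hφ).mono_left (nhdsWithin_mono _ fun x hx => ne_of_gt hx)
  refine le_of_tendsto ht ?_
  filter_upwards [Ioc_mem_nhdsGT (zero_lt_one' ℝ)] with s hs
  have h0 := h s hs
  rw [slope_def_field, sub_zero, div_le_iff₀ hs.1]
  linarith

theorem HasGradientAt.hasDerivAt_comp_line {E : Type*} [NormedAddCommGroup E]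
    [InnerProductSpace ℝ E] [CompleteSpace E] {F : E → ℝ} {y v : E} (hF : HasGradientAt F v y)
    (d : E) : HasDerivAt (fun s : ℝ => F (y + s • d)) (inner ℝ v d) 0 := by
  have h1 : HasDerivAt (fun s : ℝ => y + s • d) d 0 := by
    simpa using ((hasDerivAt_id (0 : ℝ)).smul_const d).const_add y
  have h2 : HasFDerivAt F (InnerProductSpace.toDual ℝ E v) (y + (0 : ℝ) • d) := by
    simpa using hF.hasFDerivAt
  have h3 := h2.comp_hasDerivAt (0 : ℝ) h1
  rw [InnerProductSpace.toDual_apply_apply] at h3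
  exact h3

theorem continuous_gradient {E : Type*} [NormedAddCommGroup E] [InnerProductSpace ℝ E]
    [CompleteSpace E] {f : E → ℝ} (hf : ContDiff ℝ 1 f) : Continuous (gradient f) :=
  (InnerProductSpace.toDual ℝ _).symm.continuous.comp (hf.continuous_fderiv one_ne_zero)

theorem ConvexOn.add_inner_le {E : Type*} [NormedAddCommGroup E]
    [InnerProductSpace ℝ E] [CompleteSpace E] {F : E → ℝ} {S : Set E} {x y v : E}
    (hc : ConvexOn ℝ S F) (hx : x ∈ S) (hy : y ∈ S) (hF : HasGradientAt F v y) :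
    F y + inner ℝ v (x - y) ≤ F x := by
  have := deriv_le_of_chord_le (k := F x - F y) (hF.hasDerivAt_comp_line (x - y)) ?_
  · linarith
  · intro s hs
    have h := hc.2 hy hx (sub_nonneg.2 hs.2) hs.1.le (by ring)
    have e : (1 - s) • y + s • x = y + s • (x - y) := by module
    rw [e] at h
    simp only [smul_eq_mul, zero_smul, add_zero] at h ⊢
    linarith

/-- The sublevel set at level F y is convex and contains both points, so F does not exceed F y on
the segment from y to x. -/
theorem QuasiconvexOn.inner_nonpos {E : Type*} [NormedAddCommGroup E]
    [InnerProductSpace ℝ E] [CompleteSpace E] {F : E → ℝ} {x y v : E}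
    (hc : QuasiconvexOn ℝ univ F) (hxy : F x ≤ F y) (hF : HasGradientAt F v y) :
    inner ℝ v (x - y) ≤ 0 := by
  refine deriv_le_of_chord_le (hF.hasDerivAt_comp_line (x - y)) ?_
  intro s hs
  have h := (hc (F y) ⟨mem_univ y, le_rfl⟩ ⟨mem_univ x, hxy⟩ (sub_nonneg.2 hs.2) hs.1.le
    (by ring)).2
  have e : (1 - s) • y + s • x = y + s • (x - y) := by module
  rw [e] at h
  simpa using h

/-! ## Bregman functions -/

section Bregman

variable {n : ℕ} {R : EuclideanSpace ℝ (Fin n) → WithTop ℝ}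

theorem IsBregman.hasGradientAt (hB : IsBregman R) {y : EuclideanSpace ℝ (Fin n)}
    (hy : y ∈ interior (effDom R)) : HasGradientAt (finVal R) (gradFin R y) y :=
  (((hB.contDiffOn.contDiffAt (isOpen_interior.mem_nhds hy)).differentiableAt
    one_ne_zero)).hasGradientAt

theorem IsBregman.add_inner_le (hB : IsBregman R) {x y : EuclideanSpace ℝ (Fin n)}
    (hx : x ∈ effDom R) (hy : y ∈ interior (effDom R)) :
    finVal R y + inner ℝ (gradFin R y) (x - y) ≤ finVal R x :=
  hB.strictConvex.convexOn.add_inner_le hx (interior_subset hy) (hB.hasGradientAt hy)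

theorem IsBregman.bregmanDiv_nonneg (hB : IsBregman R) {x y : EuclideanSpace ℝ (Fin n)}
    (hx : x ∈ effDom R) (hy : y ∈ interior (effDom R)) : 0 ≤ bregmanDiv R x y := by
  have := hB.add_inner_le hx hy
  unfold bregmanDiv
  linarith

/-- A limit of points whose Bregman divergence from `x` tends to `0` is `x`. -/
theorem IsBregman.eq_of_tendsto (hB : IsBregman R) {x y : EuclideanSpace ℝ (Fin n)}
    {u : ℕ → EuclideanSpace ℝ (Fin n)} (hx : x ∈ effDom R)
    (hu : ∀ i, u i ∈ interior (effDom R)) (huy : Tendsto u atTop (𝓝 y))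
    (hD : Tendsto (fun i => bregmanDiv R x (u i)) atTop (𝓝 0)) : y = x := by
  have hy : y ∈ effDom R :=
    hB.isClosed_dom.mem_of_tendsto huy (Eventually.of_forall fun i => interior_subset (hu i))
  by_contra hne
  have hconv := hB.strictConvex.1
  have hmid : ∀ z ∈ effDom R, (1 / 2 : ℝ) • z + (1 / 2 : ℝ) • x ∈ effDom R := fun z hz =>
    hconv hz hx (by norm_num) (by norm_num) (by norm_num)
  have hcont : ∀ {v : ℕ → EuclideanSpace ℝ (Fin n)} {z}, z ∈ effDom R →
      (∀ i, v i ∈ effDom R) → Tendsto v atTop (𝓝 z) →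
      Tendsto (fun i => finVal R (v i)) atTop (𝓝 (finVal R z)) := fun hz hv hvz =>
    (hB.continuousOn _ hz).tendsto.comp
      (tendsto_nhdsWithin_iff.2 ⟨hvz, Eventually.of_forall hv⟩)
  have h1 := hcont (hmid y hy) (fun i => hmid _ (interior_subset (hu i)))
    ((huy.const_smul (1 / 2 : ℝ)).add_const ((1 / 2 : ℝ) • x))
  have h2 := hcont hy (fun i => interior_subset (hu i)) huy
  have h3 := ((h2.const_mul (1 / 2 : ℝ)).add_const (1 / 2 * finVal R x)).sub
    (hD.const_mul (1 / 2 : ℝ))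
  -- The tangent at u i bounds the value at the midpoint of u i and x below by the mean of the two
  -- end values minus half the divergence. In the limit this contradicts strict convexity.
  have hle := le_of_tendsto_of_tendsto' h3 h1 fun i => by
    have := hB.add_inner_le (hmid _ (interior_subset (hu i))) (hu i)
    have e : (1 / 2 : ℝ) • u i + (1 / 2 : ℝ) • x - u i = (1 / 2 : ℝ) • (x - u i) := by module
    rw [e, inner_smul_right] at this
    simp only [bregmanDiv]
    linarith
  have hlt := hB.strictConvex.2 hy hx hne (by norm_num : (0 : ℝ) < 1 / 2)
    (by norm_num : (0 : ℝ) < 1 / 2) (by norm_num)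
  simp only [smul_eq_mul] at hlt
  linarith

end Bregman

/-! ## Convergence of mirror flows -/

/-- `t⁻¹ • μ t` tends to the limit of the derivative of `μ`. -/
theorem tendsto_inv_smul_of_hasDerivAt {E : Type*} [NormedAddCommGroup E]
    [NormedSpace ℝ E] {μ μ' : ℝ → E} {t₀ : ℝ} {v : E}
    (hμ : ∀ t, t₀ ≤ t → HasDerivAt μ (μ' t) t) (hv : Tendsto μ' atTop (𝓝 v)) :
    Tendsto (fun t => t⁻¹ • μ t) atTop (𝓝 v) := by
  rw [Metric.tendsto_nhds]
  intro ε hε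
  -- The bound 1 keeps t₁ positive, so that division by t is harmless.
  obtain ⟨t₁, ht₁⟩ := eventually_atTop.1 ((Metric.tendsto_nhds.1 hv (ε / 2) (half_pos hε)).and
    (eventually_ge_atTop (max t₀ 1)))
  have h01 : max t₀ 1 ≤ t₁ := (ht₁ t₁ le_rfl).2
  have hC : ∀ t, t₁ ≤ t → ‖(μ t - t • v) - (μ t₁ - t₁ • v)‖ ≤ ε / 2 * (t - t₁) := by
    intro t ht
    refine norm_image_sub_le_of_norm_deriv_le_segment' (a := t₁) (b := t)
      (f := fun t => μ t - t • v) (f' := fun t => μ' t - v) ?_ ?_ t ⟨ht, le_rfl⟩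
    · intro s hs
      have := ((hμ s (((le_max_left _ _).trans h01).trans hs.1)).sub
        ((hasDerivAt_id s).smul_const v)).hasDerivWithinAt (s := Icc t₁ t)
      rw [one_smul] at this
      exact this
    · intro s hs
      rw [← dist_eq_norm]
      exact (ht₁ s hs.1).1.le
  have h1 : Tendsto (fun t : ℝ => t⁻¹ * ‖μ t₁ - t₁ • v‖) atTop (𝓝 0) := by
    simpa using tendsto_inv_atTop_zero.mul_const ‖μ t₁ - t₁ • v‖
  filter_upwards [eventually_ge_atTop t₁, h1.eventually (gt_mem_nhds (half_pos hε))] with t ht h2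
  have htpos : 0 < t := by
    have := le_max_right t₀ 1
    linarith
  have e : t⁻¹ • μ t - v = t⁻¹ • (μ t - t • v) := by
    rw [smul_sub, smul_smul, inv_mul_cancel₀ htpos.ne', one_smul]
  rw [dist_eq_norm, e, norm_smul, Real.norm_of_nonneg (inv_nonneg.2 htpos.le)]
  have h3 : ‖μ t - t • v‖ ≤ ε / 2 * t + ‖μ t₁ - t₁ • v‖ := by
    have h4 := norm_le_norm_add_norm_sub (μ t₁ - t₁ • v) (μ t - t • v)
    rw [norm_sub_rev (μ t₁ - t₁ • v)] at h4
    have h5 := hC t ht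
    have : ε / 2 * (t - t₁) ≤ ε / 2 * t := by
      have := le_max_right t₀ 1
      gcongr; linarith
    linarith
  calc t⁻¹ * ‖μ t - t • v‖ ≤ t⁻¹ * (ε / 2 * t + ‖μ t₁ - t₁ • v‖) := by gcongr
    _ = ε / 2 + t⁻¹ * ‖μ t₁ - t₁ • v‖ := by field_simp
    _ < ε := by linarith

/-- A mirror flow of a Bregman function for a quasi-convex loss that attains its minimum on the
domain converges to a stationary point. -/
theorem mirrorFlow_tendsto {n : ℕ} {R : EuclideanSpace ℝ (Fin n) → WithTop ℝ}
    (hB : IsBregman R) {f : EuclideanSpace ℝ (Fin n) → ℝ} (hf : ContDiff ℝ 1 f)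
    (hq : QuasiconvexOn ℝ univ f) (hmin : ∃ x ∈ effDom R, IsMinOn f (effDom R) x)
    {x x' μ : ℝ → EuclideanSpace ℝ (Fin n)} {t₀ : ℝ}
    (hx : ∀ t, t₀ ≤ t → x t ∈ interior (effDom R))
    (hxμ : ∀ t, t₀ ≤ t → gradFin R (x t) = μ t)
    (hμ : ∀ t, t₀ ≤ t → HasDerivAt μ (-gradient f (x t)) t)
    (hx' : ∀ t, t₀ ≤ t → HasDerivAt x (x' t) t)
    (hanti : AntitoneOn (fun t => f (x t)) (Ici t₀)) :
    ∃ xs ∈ effDom R, Tendsto x atTop (𝓝 xs) ∧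
      ∀ y ∈ effDom R, 0 ≤ inner ℝ (gradient f xs) (y - xs) := by
  have hfgrad : ∀ y, HasGradientAt f (gradient f y) y := fun y =>
    (hf.differentiable one_ne_zero y).hasGradientAt
  -- divergences to points of lower loss decrease
  have hD : ∀ y ∈ effDom R, (∀ t, t₀ ≤ t → f y ≤ f (x t)) →
      AntitoneOn (fun t => bregmanDiv R y (x t)) (Ici t₀) := by
    intro y hy hfy
    -- The terms with x' cancel because ∇R(x) = μ; only -⟨μ', y - x⟩ survives.
    have hder : ∀ t, t₀ ≤ t → HasDerivAt (fun t => finVal R y - finVal R (x t) -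
        inner ℝ (μ t) (y - x t)) (inner ℝ (gradient f (x t)) (y - x t)) t := by
      intro t ht
      have h1 : HasDerivAt (fun t => finVal R (x t)) (inner ℝ (μ t) (x' t)) t := by
        have := (hB.hasGradientAt (hx t ht)).hasFDerivAt.comp_hasDerivAt t (hx' t ht)
        rw [hxμ t ht, InnerProductSpace.toDual_apply_apply] at this
        exact this
      have h2 := (hμ t ht).inner ℝ ((hx' t ht).const_sub y)
      have h3 := (h1.const_sub (finVal R y)).sub h2
      rw [inner_neg_right, inner_neg_left] at h3
      refine h3.congr_deriv ?_
      ring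
    have : AntitoneOn (fun t => finVal R y - finVal R (x t) - inner ℝ (μ t) (y - x t))
        (Ici t₀) := by
      refine antitoneOn_of_deriv_nonpos (convex_Ici t₀)
        (fun t ht => (hder t ht).continuousAt.continuousWithinAt)
        (fun t ht => (hder t (interior_subset ht)).differentiableAt.differentiableWithinAt) ?_
      intro t ht
      have ht' : t₀ ≤ t := interior_subset ht
      rw [(hder t ht').deriv]
      exact hq.inner_nonpos (hfy t ht') (hfgrad _)
    refine this.congr fun t ht => ?_
    simp only [bregmanDiv, hxμ t ht]
  -- a cluster point
  obtain ⟨xm, hxm, hxmin⟩ := hmin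
  have hbdd := hB.bounded_sublevel xm hxm (bregmanDiv R xm (x t₀))
  have hmem : ∀ k : ℕ, x (t₀ + k) ∈
      {y ∈ interior (effDom R) | bregmanDiv R xm y ≤ bregmanDiv R xm (x t₀)} := by
    intro k
    have hk : t₀ ≤ t₀ + k := by simp
    refine ⟨hx _ hk, ?_⟩
    exact hD xm hxm (fun t ht => hxmin (interior_subset (hx t ht))) self_mem_Ici hk hk
  obtain ⟨xs, -, σ, hσ, hlim⟩ := tendsto_subseq_of_bounded hbdd hmem
  have hseq : Tendsto (fun k : ℕ => t₀ + (σ k : ℝ)) atTop atTop :=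
    tendsto_atTop_add_const_left _ _ (tendsto_natCast_atTop_atTop.comp hσ.tendsto_atTop)
  have hge : ∀ k : ℕ, t₀ ≤ t₀ + (σ k : ℝ) := fun k => by simp
  have hxs : xs ∈ effDom R := hB.isClosed_dom.mem_of_tendsto hlim
    (Eventually.of_forall fun k => interior_subset (hx _ (hge k)))
  -- Monotone loss makes the cluster point a legitimate comparison point, although it need not be a
  -- minimizer.
  have hfxs : ∀ t, t₀ ≤ t → f xs ≤ f (x t) := by
    intro t ht
    refine le_of_tendsto ((hf.continuous.tendsto xs).comp hlim) ?_
    filter_upwards [hseq.eventually (eventually_ge_atTop t)] with k hk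
    exact hanti ht (hge k) hk
  have hDxs : Tendsto (fun t => bregmanDiv R xs (x t)) atTop (𝓝 0) := by
    have h1 := hB.tendsto_div xs hxs _ (fun k => hx _ (hge k)) hlim
    rw [Metric.tendsto_atTop] at h1 ⊢
    intro ε hε
    obtain ⟨N, hN⟩ := h1 ε hε
    refine ⟨t₀ + σ N, fun t ht => ?_⟩
    have ht0 : t₀ ≤ t := (hge N).trans ht
    have h2 := hD xs hxs hfxs (hge N) ht0 ht
    have h3 := hN N le_rfl
    have h4 := hB.bregmanDiv_nonneg hxs (hx t ht0)
    rw [Real.dist_0_eq_abs] at h3 ⊢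
    rw [abs_of_nonneg h4]
    exact h2.trans_lt ((le_abs_self _).trans_lt h3)
  -- Boundedness gives every sequence of times a convergent subsequence, and the vanishing
  -- divergence identifies its limit. The shift by N discards times before t₀.
  have hconv : Tendsto x atTop (𝓝 xs) := by
    refine tendsto_of_seq_tendsto fun u hu => ?_
    refine tendsto_of_subseq_tendsto fun ns hns => ?_
    obtain ⟨N, hN⟩ := eventually_atTop.1 ((hu.comp hns).eventually (eventually_ge_atTop t₀))
    have hmem' : ∀ k : ℕ, x (u (ns (k + N))) ∈
        {y ∈ interior (effDom R) | bregmanDiv R xm y ≤ bregmanDiv R xm (x t₀)} := by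
      intro k
      have hk : t₀ ≤ u (ns (k + N)) := hN (k + N) (by lia)
      exact ⟨hx _ hk, hD xm hxm (fun t ht => hxmin (interior_subset (hx t ht)))
        self_mem_Ici hk hk⟩
    obtain ⟨y, -, τ, hτ, hlim'⟩ := tendsto_subseq_of_bounded hbdd hmem'
    have htop : Tendsto (fun k => u (ns (τ k + N))) atTop atTop :=
      (hu.comp hns).comp ((tendsto_add_atTop_nat N).comp hτ.tendsto_atTop)
    have hyx : y = xs := hB.eq_of_tendsto hxs (fun k => (hmem' (τ k)).1) hlim'
      (hDxs.comp htop)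
    exact ⟨fun k => τ k + N, hyx ▸ hlim'⟩
  refine ⟨xs, hxs, hconv, fun y hy => ?_⟩
  by_contra! hneg
  have h1 : Tendsto (fun t => inner ℝ (t⁻¹ • μ t) (y - x t)) atTop
      (𝓝 (inner ℝ (-gradient f xs) (y - xs))) :=
    (tendsto_inv_smul_of_hasDerivAt hμ
      ((((continuous_gradient hf).tendsto xs).comp hconv).neg)).inner (hconv.const_sub y)
  have hpos : 0 < inner ℝ (-gradient f xs) (y - xs) := by
    rw [inner_neg_left]; linarith
  -- The linear term of the tangent bound at x t grows like t, while the value at x t converges; yet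
  -- their sum stays below the finite value at y.
  have h2 : Tendsto (fun t : ℝ => t * inner ℝ (t⁻¹ • μ t) (y - x t)) atTop atTop :=
    tendsto_id.atTop_mul_pos hpos h1
  have h3 : Tendsto (fun t => finVal R (x t)) atTop (𝓝 (finVal R xs)) :=
    (hB.continuousOn _ hxs).tendsto.comp (tendsto_nhdsWithin_iff.2 ⟨hconv, by
      filter_upwards [eventually_ge_atTop t₀] with t ht using interior_subset (hx t ht)⟩)
  obtain ⟨t, ht1, ht2, ht3⟩ := ((h3.add_atTop h2).eventually
    (eventually_gt_atTop (finVal R y))).and ((eventually_ge_atTop t₀).and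
    (eventually_gt_atTop 0)) |>.exists
  have h4 := hB.add_inner_le hy (hx t ht2)
  rw [hxμ t ht2] at h4
  rw [inner_smul_left] at ht1
  simp only [conj_trivial] at ht1
  rw [← mul_assoc, mul_inv_cancel₀ ht3.ne', one_mul] at ht1
  linarith

/-! ## Integrability of total differential equations -/

section TotalDifferentialEquation

open Metric

variable {E C G : Type*} [NormedAddCommGroup E] [NormedSpace ℝ E]
  [NormedAddCommGroup C] [NormedSpace ℝ C] [NormedAddCommGroup G] [NormedSpace ℝ G]

/-- A field of norm less than `r / 2` on the ball of radius `r` has an integral curve in this ball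
up to time `1`. -/
theorem exists_integralCurve_mem_closedBall [CompleteSpace E] {f : E → E} {p : E} {r : ℝ}
    (hr : 0 < r) {K : NNReal} (hl : LipschitzOnWith K f (closedBall p r))
    (hb : ∀ x ∈ closedBall p r, ‖f x‖ < r / 2) :
    ∃ z : ℝ → E, z 0 = p ∧ ∀ t ∈ Icc (0 : ℝ) 1, z t ∈ closedBall p r ∧
      HasDerivWithinAt z (f (z t)) (Icc 0 1) t := by
  lift r to NNReal using hr.le
  have hPL : IsPicardLindelof (fun _ => f) (tmin := 0) (tmax := 1) ⟨0, by simp⟩ p r 0 (r / 2) K :=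
    IsPicardLindelof.of_time_independent (fun x hx => by simpa using (hb x hx).le) hl (by simp)
  obtain ⟨z, hz0, hz⟩ := hPL.exists_eq_forall_mem_Icc_hasDerivWithinAt₀
  refine ⟨z, hz0, fun t ht => ⟨?_, hz t ht⟩⟩
  have hcont : ContinuousOn z (Icc 0 1) := fun t ht => (hz t ht).continuousWithinAt
  have hB : ∀ x : ℝ, HasDerivAt (fun t : ℝ => (r : ℝ) / 2 * (1 + t)) (r / 2) x := fun x => by
    simpa using ((hasDerivAt_id x).const_add 1).const_mul ((r : ℝ) / 2)
  -- The bound on f is known only inside the ball, so containment needs a barrier: it starts at r /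
  -- 2 > 0 and is below r before time 1. A first contact would thus occur inside the ball, where the
  -- curve is slower than the barrier.
  have key : ‖z t - p‖ ≤ r / 2 * (1 + t) := by
    refine image_norm_le_of_norm_deriv_right_lt_deriv_boundary' (a := 0) (b := 1)
      (f := fun t => z t - p) (f' := fun t => f (z t)) (B' := fun _ => (r : ℝ) / 2)
      (hcont.sub continuousOn_const) ?_ ?_ (fun x _ => (hB x).continuousAt.continuousWithinAt)
      (fun x _ => (hB x).hasDerivWithinAt) ?_ ht
    · intro x hx
      exact ((hz x ⟨hx.1, hx.2.le⟩).mono_of_mem_nhdsWithin (Icc_mem_nhdsGE_of_mem hx)).sub_const p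
    · simp only [] at hz0
      rw [hz0]; simpa using by positivity
    · intro x hx hxB
      refine hb _ ?_
      rw [mem_closedBall, dist_eq_norm, hxB]
      nlinarith [hx.2]
  rw [mem_closedBall, dist_eq_norm]
  nlinarith [ht.2]

/-- On compact balls, a `C¹` map is approximated by its derivative uniformly. -/
theorem ContDiffOn.exists_uniform_linear_approx [ProperSpace E] {F : E → G} {U : Set E}
    (hU : IsOpen U) (hF : ContDiffOn ℝ 1 F U) {p : E} {r : ℝ} (hr : closedBall p r ⊆ U)
    {η : ℝ} (hη : 0 < η) :
    ∃ ρ > 0, ∀ z ∈ closedBall p r, ∀ y ∈ closedBall p r, ‖y - z‖ < ρ →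
      ‖F y - F z - fderiv ℝ F z (y - z)‖ ≤ η * ‖y - z‖ := by
  have huc := (isCompact_closedBall p r).uniformContinuousOn_of_continuous
    ((hF.continuousOn_fderiv_of_isOpen hU le_rfl).mono hr)
  obtain ⟨ρ, hρ, h⟩ := Metric.uniformContinuousOn_iff.1 huc η hη
  refine ⟨ρ, hρ, fun z hz y hy hyz => ?_⟩
  refine Convex.norm_image_sub_le_of_norm_fderiv_le' (s := closedBall p r ∩ ball z ρ) (𝕜 := ℝ)
    (fun x hx => (hF.contDiffAt (hU.mem_nhds (hr hx.1))).differentiableAt one_ne_zero) ?_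
    ((convex_closedBall p r).inter (convex_ball z ρ)) ⟨hz, mem_ball_self hρ⟩ ⟨hy, by
      rwa [mem_ball, dist_eq_norm]⟩
  intro x hx
  rw [← dist_eq_norm]
  exact (h x hx.1 z hz hx.2).le

/-- **Frobenius**: the total differential equation `Dψ = F ∘ ψ` is locally solvable when
its integrability condition holds. -/
theorem exists_hasFDerivAt_of_integrable [FiniteDimensional ℝ E] {F : E → C →L[ℝ] E} {U : Set E}
    (hU : IsOpen U) (hF : ContDiffOn ℝ 1 F U)
    (hint : ∀ z ∈ U, ∀ c e : C, fderiv ℝ F z (F z c) e = fderiv ℝ F z (F z e) c)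
    {p : E} (hp : p ∈ U) :
    ∃ δ > 0, ∃ ψ : C → E, ψ 0 = p ∧
      ∀ c, ‖c‖ < δ → ψ c ∈ U ∧ HasFDerivAt ψ (F (ψ c)) c := by
  have : CompleteSpace E := FiniteDimensional.complete ℝ E
  have : ProperSpace E := FiniteDimensional.proper_real E
  obtain ⟨r₀, hr₀, hball⟩ := Metric.isOpen_iff.1 hU p hp
  -- Integral curves will stay within radius r; the doubled ball leaves room for the perturbed curve
  -- y below.
  obtain ⟨r, hr, hrr⟩ : ∃ r, 0 < r ∧ 2 * r < r₀ := ⟨r₀ / 3, by positivity, by linarith⟩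
  have hsub : closedBall p (2 * r) ⊆ U := (closedBall_subset_ball hrr).trans hball
  have hsub' : closedBall p r ⊆ closedBall p (2 * r) := closedBall_subset_closedBall (by linarith)
  have hcomp := isCompact_closedBall p (2 * r)
  obtain ⟨B, hB⟩ := hcomp.exists_bound_of_continuousOn (hF.continuousOn.mono hsub)
  obtain ⟨K, hK⟩ := hcomp.exists_bound_of_continuousOn
    ((hF.continuousOn_fderiv_of_isOpen hU le_rfl).mono hsub)
  have hp2 : p ∈ closedBall p (2 * r) := mem_closedBall_self (by positivity)
  have hB0 : 0 ≤ B := (norm_nonneg _).trans (hB p hp2)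
  have hK0 : 0 ≤ K := (norm_nonneg _).trans (hK p hp2)
  lift K to NNReal using hK0
  have hdiff : ∀ x ∈ closedBall p (2 * r), DifferentiableAt ℝ F x := fun x hx =>
    (hF.contDiffAt (hU.mem_nhds (hsub hx))).differentiableAt one_ne_zero
  have hLip : LipschitzOnWith K F (closedBall p (2 * r)) :=
    Convex.lipschitzOnWith_of_nnnorm_fderiv_le (𝕜 := ℝ) hdiff
      (fun x hx => by exact_mod_cast hK x hx) (convex_closedBall p _)
  set δ : ℝ := min 1 (r / (2 * (B + 1))) with hδ
  have hδ0 : 0 < δ := by positivity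
  have hδ1 : δ ≤ 1 := min_le_left _ _
  -- K would do as Lipschitz constant; K + 1 keeps the Grönwall constant nonzero.
  have hLipc : ∀ c : C, ‖c‖ < δ →
      LipschitzOnWith (K + 1) (fun z => F z c) (closedBall p (2 * r)) := by
    intro c hc
    refine LipschitzOnWith.of_dist_le_mul fun x hx y hy => ?_
    rw [dist_eq_norm, ← sub_apply]
    have h1 := hLip.dist_le_mul x hx y hy
    rw [dist_eq_norm] at h1
    calc ‖(F x - F y) c‖ ≤ ‖F x - F y‖ * ‖c‖ := ContinuousLinearMap.le_opNorm _ _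
      _ ≤ ‖F x - F y‖ * 1 := by gcongr; linarith
      _ ≤ K * dist x y := by linarith
      _ ≤ (K + 1 : NNReal) * dist x y := by
        gcongr; simp
  have hbc : ∀ c : C, ‖c‖ < δ → ∀ x ∈ closedBall p r, ‖F x c‖ < r / 2 := by
    intro c hc x hx
    calc ‖F x c‖ ≤ ‖F x‖ * ‖c‖ := ContinuousLinearMap.le_opNorm _ _
      _ ≤ (B + 1) * ‖c‖ := by
        gcongr
        linarith [hB x (hsub' hx)]
      _ < (B + 1) * (r / (2 * (B + 1))) := by
        gcongr
        exact hc.trans_le (min_le_right _ _)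
      _ = r / 2 := by field_simp
  have hex : ∀ c : C, ∃ z : ℝ → E, ‖c‖ < δ → z 0 = p ∧ ∀ t ∈ Icc (0 : ℝ) 1,
      z t ∈ closedBall p r ∧ HasDerivWithinAt z (F (z t) c) (Icc 0 1) t := by
    intro c
    by_cases hc : ‖c‖ < δ
    · obtain ⟨z, hz⟩ := exists_integralCurve_mem_closedBall hr ((hLipc c hc).mono hsub') (hbc c hc)
      exact ⟨z, fun _ => hz⟩
    · exact ⟨0, fun h => absurd h hc⟩
  choose z hz using hex
  -- The solution at c is the time-one value of the curve with z' = F(z) c. It remains to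
  -- differentiate it in c, by comparing the curve for c + e with a first-order guess.
  refine ⟨δ, hδ0, fun c => z c 1, ?_, fun c hc => ?_⟩
  · obtain ⟨h0, h1⟩ := hz 0 (by simpa using hδ0)
    have := constant_of_has_deriv_right_zero (f := z 0) (a := 0) (b := 1)
      (fun t ht => (h1 t ht).2.continuousWithinAt) (fun t ht => by
        have := (h1 t ⟨ht.1, ht.2.le⟩).2.mono_of_mem_nhdsWithin (Icc_mem_nhdsGE_of_mem ht)
        rwa [map_zero] at this) 1 (by simp)
    exact this.trans h0
  obtain ⟨hz0, hzc⟩ := hz c hc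
  have h1mem : (1 : ℝ) ∈ Icc (0 : ℝ) 1 := by simp
  refine ⟨hsub (hsub' (hzc 1 h1mem).1), ?_⟩
  rw [hasFDerivAt_iff_isLittleO_nhds_zero, Asymptotics.isLittleO_iff]
  intro ε hε
  -- The factor by which Grönwall multiplies a constant defect over unit time.
  set κ : ℝ := 1 / (K + 1 : ℝ) * (Real.exp (K + 1) - 1) with hκ
  have hκ0 : 0 ≤ κ := by
    have : 1 ≤ Real.exp (K + 1) := Real.one_le_exp (by positivity)
    have := sub_nonneg.2 this
    positivity
  obtain ⟨η, hη, hηε⟩ : ∃ η > 0, κ * (η * (B + 1)) ≤ ε / 2 :=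
    ⟨ε / (2 * (κ + 1) * (B + 1)), by positivity, by
      have : κ / (κ + 1) ≤ 1 := by rw [div_le_one (by positivity)]; linarith
      calc κ * (ε / (2 * (κ + 1) * (B + 1)) * (B + 1)) = κ / (κ + 1) * (ε / 2) := by field_simp
        _ ≤ 1 * (ε / 2) := by gcongr
        _ = ε / 2 := one_mul _⟩
  obtain ⟨ρ, hρ, happ⟩ := hF.exists_uniform_linear_approx hU hsub hη
  have hev : ∀ᶠ e : C in 𝓝 0, ‖c + e‖ < δ ∧ (B + 1) * ‖e‖ < ρ ∧ (B + 1) * ‖e‖ < r ∧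
      κ * (K * (B + 1) * ‖e‖) < ε / 2 := by
    have t1 : Tendsto (fun e : C => ‖c + e‖) (𝓝 0) (𝓝 ‖c‖) :=
      (by fun_prop : Continuous fun e : C => ‖c + e‖).tendsto' _ _ (by simp)
    have t2 : Tendsto (fun e : C => (B + 1) * ‖e‖) (𝓝 0) (𝓝 0) :=
      (by fun_prop : Continuous fun e : C => (B + 1) * ‖e‖).tendsto' _ _ (by simp)
    have t3 : Tendsto (fun e : C => κ * (K * (B + 1) * ‖e‖)) (𝓝 0) (𝓝 0) :=
      (by fun_prop : Continuous fun e : C => κ * (K * (B + 1) * ‖e‖)).tendsto' _ _ (by simp)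
    exact (t1.eventually (gt_mem_nhds hc)).and ((t2.eventually (gt_mem_nhds hρ)).and
      ((t2.eventually (gt_mem_nhds hr)).and (t3.eventually (gt_mem_nhds (half_pos hε)))))
  filter_upwards [hev] with e ⟨he1, he2, he3, he4⟩
  obtain ⟨hy0, hyc⟩ := hz (c + e) he1
  -- the first-order approximation of the perturbed curve
  set y : ℝ → E := fun τ => z c τ + τ • F (z c τ) e with hy
  set y' : ℝ → E := fun τ => F (z c τ) c +
    (τ • fderiv ℝ F (z c τ) (F (z c τ) c) e + F (z c τ) e) with hy'
  have hyder : ∀ τ ∈ Icc (0 : ℝ) 1, HasDerivWithinAt y (y' τ) (Icc 0 1) τ := by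
    intro τ hτ
    have d1 := (hzc τ hτ).2
    have d2 := (hdiff _ (hsub' (hzc τ hτ).1)).hasFDerivAt.comp_hasDerivWithinAt τ d1
    have d3 := d2.clm_apply (hasDerivWithinAt_const τ (Icc (0 : ℝ) 1) e)
    have d4 := d1.add ((hasDerivWithinAt_id τ (Icc (0 : ℝ) 1)).smul d3)
    simp only [map_zero, add_zero, one_smul] at d4
    exact d4
  have hFe : ∀ τ ∈ Icc (0 : ℝ) 1, ‖τ • F (z c τ) e‖ ≤ (B + 1) * ‖e‖ := by
    intro τ hτ
    rw [norm_smul, Real.norm_of_nonneg hτ.1]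
    calc τ * ‖F (z c τ) e‖ ≤ 1 * (‖F (z c τ)‖ * ‖e‖) := by
          gcongr
          · exact hτ.2
          · exact ContinuousLinearMap.le_opNorm _ _
      _ ≤ (B + 1) * ‖e‖ := by
          rw [one_mul]; gcongr
          linarith [hB _ (hsub' (hzc τ hτ).1)]
  have hymem : ∀ τ ∈ Icc (0 : ℝ) 1, y τ ∈ closedBall p (2 * r) := by
    intro τ hτ
    have h1 := (hzc τ hτ).1
    rw [mem_closedBall, dist_eq_norm] at h1 ⊢
    calc ‖y τ - p‖ = ‖(z c τ - p) + τ • F (z c τ) e‖ := by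
          congr 1; simp only [hy]; abel
      _ ≤ ‖z c τ - p‖ + ‖τ • F (z c τ) e‖ := norm_add_le _ _
      _ ≤ 2 * r := by linarith [hFe τ hτ]
  set θ : ℝ := (K * (B + 1) * ‖e‖ + η * (B + 1)) * ‖e‖ with hθ
  have hybound : ∀ τ ∈ Icc (0 : ℝ) 1, dist (y' τ) (F (y τ) (c + e)) ≤ θ := by
    intro τ hτ
    have hzm := (hzc τ hτ).1
    have hyz : y τ - z c τ = τ • F (z c τ) e := by simp [hy]
    have h1 := happ _ (hsub' hzm) _ (hymem τ hτ) (by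
      rw [hyz]; exact (hFe τ hτ).trans_lt he2)
    rw [hyz] at h1
    set rem := F (y τ) - F (z c τ) - fderiv ℝ F (z c τ) (τ • F (z c τ) e) with hrem
    have hsplit : F (y τ) (c + e) - y' τ =
        fderiv ℝ F (z c τ) (τ • F (z c τ) e) e + rem (c + e) := by
      -- Integrability cancels the terms linear in e; what is left is quadratic in e or controlled
      -- by the linearization error.
      have hs := hint _ (hsub (hsub' hzm)) c e
      simp only [hrem, hy', sub_apply, map_add, map_smul,
        smul_apply, hs]
      abel
    have hce : ‖c + e‖ ≤ 1 := he1.le.trans hδ1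
    have hb2 : ‖rem (c + e)‖ ≤ η * ((B + 1) * ‖e‖) := by
      calc ‖rem (c + e)‖ ≤ ‖rem‖ * ‖c + e‖ := ContinuousLinearMap.le_opNorm _ _
        _ ≤ ‖rem‖ * 1 := by gcongr
        _ ≤ η * ‖τ • F (z c τ) e‖ := by rw [mul_one]; exact h1
        _ ≤ η * ((B + 1) * ‖e‖) := by gcongr; exact hFe τ hτ
    have hb1 : ‖fderiv ℝ F (z c τ) (τ • F (z c τ) e) e‖ ≤ K * ((B + 1) * ‖e‖) * ‖e‖ := by
      calc _ ≤ ‖fderiv ℝ F (z c τ) (τ • F (z c τ) e)‖ * ‖e‖ := ContinuousLinearMap.le_opNorm _ _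
        _ ≤ ‖fderiv ℝ F (z c τ)‖ * ‖τ • F (z c τ) e‖ * ‖e‖ := by
          gcongr; exact ContinuousLinearMap.le_opNorm _ _
        _ ≤ K * ((B + 1) * ‖e‖) * ‖e‖ := by
          gcongr
          · exact hK _ (hsub' hzm)
          · exact hFe τ hτ
    rw [dist_comm, dist_eq_norm, hsplit]
    refine (norm_add_le _ _).trans ((add_le_add hb1 hb2).trans_eq ?_)
    rw [hθ]; ring
  have hgr := dist_le_of_approx_trajectories_ODE_of_mem (v := fun _ x => F x (c + e))
    (s := fun _ => closedBall p (2 * r)) (K := K + 1) (f := z (c + e)) (g := y)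
    (f' := fun t => F (z (c + e) t) (c + e)) (g' := y') (a := 0) (b := 1) (εf := 0) (εg := θ)
    (δ := 0) (fun _ _ => hLipc _ he1) (fun t ht => (hyc t ht).2.continuousWithinAt)
    (fun t ht => (hyc t ⟨ht.1, ht.2.le⟩).2.mono_of_mem_nhdsWithin (Icc_mem_nhdsGE_of_mem ht))
    (fun t _ => (dist_self _).le) (fun t ht => hsub' (hyc t ⟨ht.1, ht.2.le⟩).1)
    (fun t ht => (hyder t ht).continuousWithinAt)
    (fun t ht => (hyder t ⟨ht.1, ht.2.le⟩).mono_of_mem_nhdsWithin (Icc_mem_nhdsGE_of_mem ht))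
    (fun t ht => hybound t ⟨ht.1, ht.2.le⟩) (fun t ht => hymem t ⟨ht.1, ht.2.le⟩)
    (by simp [hy, hy0, hz0]) 1 h1mem
  rw [gronwallBound_of_K_ne_0 (by positivity)] at hgr
  have hfin : z (c + e) 1 - z c 1 - F (z c 1) e = z (c + e) 1 - y 1 := by
    simp only [hy, one_smul]; abel
  rw [hfin, ← dist_eq_norm]
  have hval : (0 : ℝ) * Real.exp (((K + 1 : NNReal) : ℝ) * (1 - 0)) + (0 + θ) / ((K + 1 : NNReal) : ℝ) *
      (Real.exp (((K + 1 : NNReal) : ℝ) * (1 - 0)) - 1) =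
      (κ * (K * (B + 1) * ‖e‖) + κ * (η * (B + 1))) * ‖e‖ := by
    rw [hκ, hθ]; push_cast; simp only [sub_zero, mul_one]; ring
  refine (hgr.trans_eq hval).trans ?_
  gcongr
  linarith

end TotalDifferentialEquation

/-! ## Local parametrizations of submanifolds -/

theorem two_le_contDiff_infty : (2 : WithTop ℕ∞) ≤ ∞ := by
  exact WithTop.coe_le_coe.2 (le_top : (2 : ℕ∞) ≤ ⊤)

/-- `σ : U → M` is a smooth parametrization of a neighbourhood `M ∩ W` in `M`, and
`Θ` is a smooth map on `W` that inverts it. -/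
structure IsLocalParam {X E : Type*} [NormedAddCommGroup X] [NormedSpace ℝ X]
    [NormedAddCommGroup E] [NormedSpace ℝ E] (M : Set X) (U : Set E) (W : Set X)
    (σ : E → X) (Θ : X → E) : Prop where
  isOpen_source : IsOpen U
  isOpen_target : IsOpen W
  contDiffOn : ContDiffOn ℝ ∞ σ U
  contDiffOn_inv : ContDiffOn ℝ ∞ Θ W
  mapsTo : MapsTo σ U (M ∩ W)
  mapsTo_inv : MapsTo Θ (M ∩ W) U
  left_inv : ∀ v ∈ U, Θ (σ v) = v
  right_inv : ∀ w ∈ M ∩ W, σ (Θ w) = w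

/-- The parametrization is the inverse of a straightening chart, restricted to V. Following the
chart by the orthogonal projection onto V gives an inverse that is smooth on an open set of the
ambient space and unchanged on M. -/
theorem IsSmoothSubmanifold.exists_isLocalParam {D : ℕ} {M : Set (EuclideanSpace ℝ (Fin D))}
    (hM : IsSmoothSubmanifold M) {p : EuclideanSpace ℝ (Fin D)} (hp : p ∈ M) :
    ∃ (V : Submodule ℝ (EuclideanSpace ℝ (Fin D))) (U : Set V)
      (W : Set (EuclideanSpace ℝ (Fin D))) (σ : V → EuclideanSpace ℝ (Fin D))
      (Θ : EuclideanSpace ℝ (Fin D) → V), p ∈ W ∧ IsLocalParam M U W σ Θ := by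
  obtain ⟨m, hm⟩ := hM
  obtain ⟨Φ, V, hpΦ, hΦ, hΦs, -, hiff⟩ := hm p hp
  refine ⟨V, V.subtypeL ⁻¹' Φ.target, Φ.source, Φ.symm ∘ V.subtypeL,
    V.orthogonalProjectionOnto ∘ Φ, hpΦ, ?_⟩
  have hproj : ∀ w ∈ M ∩ Φ.source, ((V.orthogonalProjectionOnto (Φ w) : V) :
      EuclideanSpace ℝ (Fin D)) = Φ w := fun w hw =>
    Submodule.starProjection_eq_self_iff.2 ((hiff w hw.2).1 hw.1)
  refine ⟨Φ.open_target.preimage V.subtypeL.continuous, Φ.open_source,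
    hΦs.comp V.subtypeL.contDiff.contDiffOn (mapsTo_preimage _ _),
    V.orthogonalProjectionOnto.contDiff.comp_contDiffOn hΦ, ?_, ?_, ?_, ?_⟩
  · intro v hv
    have hs := Φ.map_target hv
    refine ⟨(hiff _ hs).2 ?_, hs⟩
    rw [Φ.right_inv hv]
    exact v.2
  · intro w hw
    change ((V.orthogonalProjectionOnto (Φ w) : V) : EuclideanSpace ℝ (Fin D)) ∈ Φ.target
    rw [hproj w hw]
    exact Φ.map_source hw.2
  · intro v hv
    simp only [Function.comp_apply]
    rw [Φ.right_inv hv]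
    exact Submodule.orthogonalProjectionOnto_mem_subspace_eq_self v
  · intro w hw
    simp only [Function.comp_apply]
    change Φ.symm ((V.orthogonalProjectionOnto (Φ w) : V) : EuclideanSpace ℝ (Fin D)) = w
    rw [hproj w hw, Φ.left_inv hw.2]

/-- The metric induced by a linear map into an inner product space, as a map into the dual. -/
noncomputable def inducedMetric {X E : Type*} [NormedAddCommGroup X] [InnerProductSpace ℝ X]
    [NormedAddCommGroup E] [NormedSpace ℝ E] (A : E →L[ℝ] X) : E →L[ℝ] E →L[ℝ] ℝ :=
  ((ContinuousLinearMap.compL ℝ E X ℝ).flip A) ∘L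
    ((isBoundedBilinearMap_inner (𝕜 := ℝ) (E := X)).toContinuousLinearMap ∘L A)

theorem inducedMetric_apply {X E : Type*} [NormedAddCommGroup X] [InnerProductSpace ℝ X]
    [NormedAddCommGroup E] [NormedSpace ℝ E] (A : E →L[ℝ] X) (u v : E) :
    inducedMetric A u v = inner ℝ (A u) (A v) := rfl

/-- The form is positive definite, hence nondegenerate, and the dimensions agree. This keeps
`ContinuousLinearMap.inverse` in `pullbackGrad` away from its default value 0 and makes it smooth
there. -/
theorem exists_equiv_eq_inducedMetric {X E : Type*} [NormedAddCommGroup X]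
    [InnerProductSpace ℝ X] [NormedAddCommGroup E] [NormedSpace ℝ E] [FiniteDimensional ℝ E]
    {A : E →L[ℝ] X} (hA : Function.Injective A) :
    ∃ e : E ≃L[ℝ] (E →L[ℝ] ℝ), (e : E →L[ℝ] E →L[ℝ] ℝ) = inducedMetric A := by
  have hinj : Function.Injective (inducedMetric A : E →ₗ[ℝ] E →L[ℝ] ℝ) := by
    rw [injective_iff_map_eq_zero]
    intro u hu
    have : inner ℝ (A u) (A u) = (0 : ℝ) := by
      rw [← inducedMetric_apply]
      exact congrArg (fun l : E →L[ℝ] ℝ => l u) hu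
    rw [inner_self_eq_zero] at this
    exact hA (this.trans (map_zero A).symm)
  have hdim : Module.finrank ℝ E = Module.finrank ℝ (E →L[ℝ] ℝ) := by
    rw [← (LinearMap.toContinuousLinearMap (𝕜 := ℝ) (E := E) (F' := ℝ)).finrank_eq]
    exact Subspace.dual_finrank_eq.symm
  refine ⟨(LinearMap.linearEquivOfInjective _ hinj hdim).toContinuousLinearEquiv, ?_⟩
  ext u v
  rfl

theorem ContDiffOn.inducedMetric {X E G : Type*} [NormedAddCommGroup X] [InnerProductSpace ℝ X]
    [NormedAddCommGroup E] [NormedSpace ℝ E] [NormedAddCommGroup G] [NormedSpace ℝ G]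
    {k : WithTop ℕ∞} {A : G → E →L[ℝ] X} {s : Set G} (hA : ContDiffOn ℝ k A s) :
    ContDiffOn ℝ k (fun x => inducedMetric (A x)) s :=
  ((ContinuousLinearMap.contDiff _).comp_contDiffOn hA).clm_comp (contDiffOn_const.clm_comp hA)

namespace IsLocalParam

/-! ### Tangent spaces and differentiability in local coordinates -/

section Tangent

variable {X E G : Type*} [NormedAddCommGroup X] [NormedSpace ℝ X]
  [NormedAddCommGroup E] [NormedSpace ℝ E] [NormedAddCommGroup G] [NormedSpace ℝ G]
  {M : Set X} {U : Set E} {W : Set X} {σ : E → X} {Θ : X → E}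

theorem hasFDerivAt (h : IsLocalParam M U W σ Θ) {v : E} (hv : v ∈ U) :
    HasFDerivAt σ (fderiv ℝ σ v) v :=
  ((h.contDiffOn.contDiffAt (h.isOpen_source.mem_nhds hv)).differentiableAt
    (by simp)).hasFDerivAt

theorem hasFDerivAt_inv (h : IsLocalParam M U W σ Θ) {w : X} (hw : w ∈ W) :
    HasFDerivAt Θ (fderiv ℝ Θ w) w :=
  ((h.contDiffOn_inv.contDiffAt (h.isOpen_target.mem_nhds hw)).differentiableAt
    (by simp)).hasFDerivAt

theorem fderiv_injective (h : IsLocalParam M U W σ Θ) {v : E} (hv : v ∈ U) :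
    Function.Injective (fderiv ℝ σ v) := by
  have h1 := (h.hasFDerivAt_inv (h.mapsTo hv).2).comp v (h.hasFDerivAt hv)
  have h2 : HasFDerivAt (Θ ∘ σ) (ContinuousLinearMap.id ℝ E) v :=
    (hasFDerivAt_id v).congr_of_eventuallyEq (by
      filter_upwards [h.isOpen_source.mem_nhds hv] with x hx using h.left_inv x hx)
  intro a b hab
  have := congrArg (fun l : E →L[ℝ] E => l (a - b)) (h1.unique h2)
  simp only [ContinuousLinearMap.comp_apply, map_sub, hab, sub_self,
    ContinuousLinearMap.id_apply] at this
  exact sub_eq_zero.1 this.symm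

/-- On M the identity is locally σ ∘ Θ, and derivatives within M agree on the tangent cone, so a
tangent vector y equals Dσ (DΘ y). Conversely, Dσ carries the tangent cone of the open set U, which
is everything, into that of M. -/
theorem span_tangentConeAt (h : IsLocalParam M U W σ Θ) {v : E} (hv : v ∈ U) :
    Submodule.span ℝ (tangentConeAt ℝ M (σ v)) = (fderiv ℝ σ v : E →ₗ[ℝ] X).range := by
  have hw := h.mapsTo hv
  refine le_antisymm (Submodule.span_le.2 fun y hy => ?_) ?_
  · have hσ : HasFDerivAt σ (fderiv ℝ σ v) (Θ (σ v)) := by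
      rw [h.left_inv v hv]; exact h.hasFDerivAt hv
    have h1 : HasFDerivWithinAt (σ ∘ Θ) _ M (σ v) :=
      (hσ.comp (σ v) (h.hasFDerivAt_inv hw.2)).hasFDerivWithinAt
    have h2 : HasFDerivWithinAt (σ ∘ Θ) (ContinuousLinearMap.id ℝ X) M (σ v) :=
      (hasFDerivWithinAt_id (σ v) M).congr_of_eventuallyEq (by
        filter_upwards [self_mem_nhdsWithin,
          mem_nhdsWithin_of_mem_nhds (h.isOpen_target.mem_nhds hw.2)] with x hx hx'
        exact h.right_inv x ⟨hx, hx'⟩) (h.right_inv _ hw)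
    have := HasFDerivWithinAt.unique_on h1 h2 hy
    exact ⟨fderiv ℝ Θ (σ v) y, this⟩
  · rintro _ ⟨u, rfl⟩
    refine Submodule.subset_span ?_
    have hu : u ∈ tangentConeAt ℝ U v := by
      rw [tangentConeAt_of_mem_nhds (h.isOpen_source.mem_nhds hv)]; trivial
    exact tangentConeAt_mono (image_subset_iff.2 fun x hx => (h.mapsTo hx).1)
      ((h.hasFDerivAt hv).hasFDerivWithinAt.mapsTo_tangent_cone hu)

theorem hasFDerivAt_comp (h : IsLocalParam M U W σ Θ) {φ : X → G} {φ' : X →L[ℝ] G} {v : E}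
    (hv : v ∈ U) (hφ : HasFDerivWithinAt φ φ' M (σ v)) :
    HasFDerivAt (φ ∘ σ) (φ' ∘L fderiv ℝ σ v) v :=
  (hφ.comp v (h.hasFDerivAt hv).hasFDerivWithinAt fun _ hx => (h.mapsTo hx).1).hasFDerivAt
    (h.isOpen_source.mem_nhds hv)

theorem fderivWithin_fderiv (h : IsLocalParam M U W σ Θ) {φ : X → G} {v : E}
    (hv : v ∈ U) (hφ : DifferentiableWithinAt ℝ φ M (σ v)) (u : E) :
    fderivWithin ℝ φ M (σ v) (fderiv ℝ σ v u) = fderiv ℝ (φ ∘ σ) v u := by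
  rw [(h.hasFDerivAt_comp hv hφ.hasFDerivWithinAt).fderiv]
  rfl

/-- A map on `M` that is differentiable in the parameter is differentiable within `M`. -/
theorem differentiableWithinAt (h : IsLocalParam M U W σ Θ) {φ : X → G} {v : E}
    (hv : v ∈ U) (hφ : DifferentiableAt ℝ (φ ∘ σ) v) : DifferentiableWithinAt ℝ φ M (σ v) := by
  have hw := h.mapsTo hv
  have hφ' : DifferentiableAt ℝ (φ ∘ σ) (Θ (σ v)) := by rwa [h.left_inv v hv]
  refine ((hφ'.comp (σ v) (h.hasFDerivAt_inv hw.2).differentiableAt).differentiableWithinAt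
    (s := M)).congr_of_eventuallyEq ?_ ?_
  · filter_upwards [self_mem_nhdsWithin,
      mem_nhdsWithin_of_mem_nhds (h.isOpen_target.mem_nhds hw.2)] with x hx hx'
    simp only [Function.comp_apply, h.right_inv x ⟨hx, hx'⟩]
  · simp only [Function.comp_apply, h.left_inv v hv]

/-- Near p in M, φ is the restriction of the ambient C¹ map (φ ∘ σ) ∘ Θ. -/
theorem exists_lipschitzOnWith (h : IsLocalParam M U W σ Θ) {φ : X → G} {p : X}
    (hp : p ∈ M ∩ W) (hφ : ContDiffOn ℝ 1 (φ ∘ σ) U) :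
    ∃ K, ∃ N ∈ 𝓝[M] p, LipschitzOnWith K φ N := by
  have hΘ : ContDiffAt ℝ 1 Θ p :=
    (h.contDiffOn_inv.contDiffAt (h.isOpen_target.mem_nhds hp.2)).of_le (by simp)
  have h1 : ContDiffAt ℝ 1 ((φ ∘ σ) ∘ Θ) p :=
    (hφ.contDiffAt (h.isOpen_source.mem_nhds (h.mapsTo_inv hp))).comp p hΘ
  obtain ⟨K, N, hN, hK⟩ := h1.exists_lipschitzOnWith
  refine ⟨K, N ∩ (M ∩ W), ?_, ?_⟩
  · exact inter_mem (mem_nhdsWithin_of_mem_nhds hN) (inter_mem self_mem_nhdsWithin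
      (mem_nhdsWithin_of_mem_nhds (h.isOpen_target.mem_nhds hp.2)))
  · intro x hx y hy
    have := hK hx.1 hy.1
    simpa only [Function.comp_apply, h.right_inv x hx.2, h.right_inv y hy.2] using this

end Tangent

/-! ### Gradient fields in local coordinates -/

section Gradient

variable {D : ℕ} {E : Type*} [NormedAddCommGroup E] [NormedSpace ℝ E]
  {M : Set (EuclideanSpace ℝ (Fin D))} {U : Set E} {W : Set (EuclideanSpace ℝ (Fin D))}
  {σ : E → EuclideanSpace ℝ (Fin D)} {Θ : EuclideanSpace ℝ (Fin D) → E}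
  {φ χ : EuclideanSpace ℝ (Fin D) → ℝ}

/-- The gradient of `φ` on `M` in the coordinates given by the parametrization `σ`. -/
noncomputable def pullbackGrad (σ : E → EuclideanSpace ℝ (Fin D))
    (φ : EuclideanSpace ℝ (Fin D) → ℝ) (v : E) : E :=
  (inducedMetric (fderiv ℝ σ v)).inverse (fderiv ℝ (φ ∘ σ) v)

/-- The gradient is tangent, so it is Dσ y for some y. Pairing it with each Dσ u shows that the
metric sends y to the derivative of φ ∘ σ, which determines y. -/
theorem fderiv_pullbackGrad [FiniteDimensional ℝ E] (h : IsLocalParam M U W σ Θ) {v : E}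
    (hv : v ∈ U) (hφ : DifferentiableWithinAt ℝ φ M (σ v)) :
    fderiv ℝ σ v (pullbackGrad σ φ v) = gradOn M φ (σ v) := by
  obtain ⟨e, he⟩ := exists_equiv_eq_inducedMetric (h.fderiv_injective hv)
  have hmem : gradOn M φ (σ v) ∈ (fderiv ℝ σ v : E →ₗ[ℝ] _).range := by
    rw [← h.span_tangentConeAt hv]
    exact Submodule.starProjection_apply_mem _ _
  obtain ⟨y, hy⟩ := hmem
  have hy' : fderiv ℝ σ v y = gradOn M φ (σ v) := hy
  have hey : e y = fderiv ℝ (φ ∘ σ) v := by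
    ext u
    have h1 : e y u = inducedMetric (fderiv ℝ σ v) y u := by rw [← he]; rfl
    have h2 : fderiv ℝ σ v u ∈ tangentSpaceAt M (σ v) := by
      unfold tangentSpaceAt
      rw [h.span_tangentConeAt hv]
      exact ⟨u, rfl⟩
    rw [h1, inducedMetric_apply, hy', gradOn, Submodule.inner_starProjection_left_eq_right,
      Submodule.starProjection_eq_self_iff.2 h2, ← h.fderivWithin_fderiv hv hφ, gradientWithin,
      InnerProductSpace.toDual_symm_apply]
  rw [pullbackGrad, ← he, ContinuousLinearMap.inverse_equiv, ← hey]
  simpa using hy'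

theorem contDiffOn_pullbackGrad [FiniteDimensional ℝ E] (h : IsLocalParam M U W σ Θ)
    (hφ : ContDiffOn ℝ 2 φ M) : ContDiffOn ℝ 1 (pullbackGrad σ φ) U := by
  have : CompleteSpace E := FiniteDimensional.complete ℝ E
  have h1 : ContDiffOn ℝ 1 (fderiv ℝ (φ ∘ σ)) U :=
    (hφ.comp (h.contDiffOn.of_le two_le_contDiff_infty)
      fun _ hx => (h.mapsTo hx).1).fderiv_of_isOpen h.isOpen_source (by norm_num)
  have h2 : ContDiffOn ℝ 1 (fun v => inducedMetric (fderiv ℝ σ v)) U :=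
    (h.contDiffOn.fderiv_of_isOpen h.isOpen_source
      (one_add_one_eq_two.trans_le two_le_contDiff_infty)).inducedMetric
  refine ContDiffOn.clm_apply (fun v hv => ?_) h1
  obtain ⟨e, he⟩ := exists_equiv_eq_inducedMetric (h.fderiv_injective hv)
  have h3 : ContDiffAt ℝ 1 ContinuousLinearMap.inverse (inducedMetric (fderiv ℝ σ v)) := by
    rw [← he]; exact contDiffAt_map_inverse e
  exact h3.comp_contDiffWithinAt v (h2 v hv)

theorem contDiffOn_gradOn_comp [FiniteDimensional ℝ E] (h : IsLocalParam M U W σ Θ)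
    (hφ : ContDiffOn ℝ 2 φ M) : ContDiffOn ℝ 1 (gradOn M φ ∘ σ) U := by
  have h1 : ContDiffOn ℝ 1 (fun v => fderiv ℝ σ v (pullbackGrad σ φ v)) U :=
    (h.contDiffOn.fderiv_of_isOpen h.isOpen_source
      (one_add_one_eq_two.trans_le two_le_contDiff_infty)).clm_apply
      (h.contDiffOn_pullbackGrad hφ)
  refine h1.congr fun v hv => ?_
  exact (h.fderiv_pullbackGrad hv
    (hφ.differentiableOn (by norm_num) _ (h.mapsTo hv).1)).symm

/-- The derivative of a gradient field on `M` in a tangent direction, in coordinates. -/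
theorem fderivWithin_gradOn [FiniteDimensional ℝ E] (h : IsLocalParam M U W σ Θ)
    (hφ : ContDiffOn ℝ 2 φ M) {v : E} (hv : v ∈ U) (u : E) :
    fderivWithin ℝ (gradOn M φ) M (σ v) (fderiv ℝ σ v u) =
      fderiv ℝ σ v (fderiv ℝ (pullbackGrad σ φ) v u) +
        fderiv ℝ (fderiv ℝ σ) v u (pullbackGrad σ φ v) := by
  have hU := h.isOpen_source.mem_nhds hv
  have hd : DifferentiableAt ℝ (gradOn M φ ∘ σ) v :=
    ((h.contDiffOn_gradOn_comp hφ).contDiffAt hU).differentiableAt one_ne_zero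
  rw [h.fderivWithin_fderiv hv (h.differentiableWithinAt hv hd)]
  have hev : gradOn M φ ∘ σ =ᶠ[𝓝 v] fun v => fderiv ℝ σ v (pullbackGrad σ φ v) := by
    filter_upwards [hU] with x hx
    exact (h.fderiv_pullbackGrad hx
      (hφ.differentiableOn (by norm_num) _ (h.mapsTo hx).1)).symm
  have hdσ : DifferentiableAt ℝ (fderiv ℝ σ) v :=
    ((h.contDiffOn.fderiv_of_isOpen (m := 1) h.isOpen_source
      (one_add_one_eq_two.trans_le two_le_contDiff_infty)).contDiffAt hU).differentiableAt one_ne_zero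
  have hdY : DifferentiableAt ℝ (pullbackGrad σ φ) v :=
    ((h.contDiffOn_pullbackGrad hφ).contDiffAt hU).differentiableAt one_ne_zero
  rw [hev.fderiv_eq, fderiv_clm_apply hdσ hdY]
  rfl

/-- Commuting gradient fields on `M` commute in coordinates. -/
theorem fderiv_pullbackGrad_comm [FiniteDimensional ℝ E] (h : IsLocalParam M U W σ Θ)
    (hφ : ContDiffOn ℝ 2 φ M) (hχ : ContDiffOn ℝ 2 χ M) {v : E} (hv : v ∈ U)
    (hcomm : VectorField.lieBracketWithin ℝ (gradOn M φ) (gradOn M χ) M (σ v) = 0) :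
    fderiv ℝ (pullbackGrad σ χ) v (pullbackGrad σ φ v) =
      fderiv ℝ (pullbackGrad σ φ) v (pullbackGrad σ χ v) := by
  have hm := (h.mapsTo hv).1
  have hsymm : IsSymmSndFDerivAt ℝ σ v :=
    (h.contDiffOn.contDiffAt (h.isOpen_source.mem_nhds hv)).isSymmSndFDerivAt (by
      rw [minSmoothness_of_isRCLikeNormedField]; exact two_le_contDiff_infty)
  rw [VectorField.lieBracketWithin,
    ← h.fderiv_pullbackGrad hv (hφ.differentiableOn (by norm_num) _ hm),
    ← h.fderiv_pullbackGrad hv (hχ.differentiableOn (by norm_num) _ hm),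
    h.fderivWithin_gradOn hχ hv, h.fderivWithin_gradOn hφ hv,
    -- The second-derivative terms of σ cancel by symmetry, so the bracket on M is Dσ of the bracket
    -- in coordinates.
    hsymm.eq (pullbackGrad σ φ v) (pullbackGrad σ χ v), add_sub_add_right_eq_sub, ← map_sub] at hcomm
  exact sub_eq_zero.1 (h.fderiv_injective hv (hcomm.trans (map_zero _).symm))

end Gradient

end IsLocalParam

/-! ## Joint flows of commuting gradient fields -/

section FlowBox

variable {D : ℕ} {ι : Type} {M : Set (EuclideanSpace ℝ (Fin D))}

/-- The map that takes coefficients to the linear combination of the gradients at `w`. -/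
noncomputable def jointGrad [Fintype ι] (M : Set (EuclideanSpace ℝ (Fin D)))
    (G : ι → EuclideanSpace ℝ (Fin D) → ℝ) (w : EuclideanSpace ℝ (Fin D)) :
    (ι → ℝ) →L[ℝ] EuclideanSpace ℝ (Fin D) :=
  ∑ i, (ContinuousLinearMap.proj (R := ℝ) (φ := fun _ : ι => ℝ) i).smulRight (gradOn M (G i) w)

theorem jointGrad_apply [Fintype ι] (G : ι → EuclideanSpace ℝ (Fin D) → ℝ)
    (w : EuclideanSpace ℝ (Fin D)) (c : ι → ℝ) :
    jointGrad M G w c = ∑ i, c i • gradOn M (G i) w := by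
  simp [jointGrad]

theorem jointGrad_single [Fintype ι] [DecidableEq ι] (G : ι → EuclideanSpace ℝ (Fin D) → ℝ)
    (w : EuclideanSpace ℝ (Fin D)) (i : ι) :
    jointGrad M G w (Pi.single i 1) = gradOn M (G i) w := by
  rw [jointGrad_apply, Finset.sum_eq_single i] <;> simp +contextual

theorem IsSmoothSubmanifold.exists_lipschitzOnWith_jointGrad [Fintype ι]
    (hM : IsSmoothSubmanifold M) {G : ι → EuclideanSpace ℝ (Fin D) → ℝ}
    (hG : ∀ i, ContDiffOn ℝ 2 (G i) M) {p : EuclideanSpace ℝ (Fin D)} (hp : p ∈ M) :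
    ∃ K, ∃ N ∈ 𝓝[M] p, LipschitzOnWith K (jointGrad M G) N := by
  obtain ⟨V, U, W, σ, Θ, hpW, h⟩ := hM.exists_isLocalParam hp
  exact h.exists_lipschitzOnWith ⟨hp, hpW⟩
    (ContDiffOn.sum fun i _ => contDiffOn_const.smulRight (h.contDiffOn_gradOn_comp (hG i)))

theorem IsSmoothSubmanifold.continuousOn_jointGrad [Fintype ι] (hM : IsSmoothSubmanifold M)
    {G : ι → EuclideanSpace ℝ (Fin D) → ℝ} (hG : ∀ i, ContDiffOn ℝ 2 (G i) M) :
    ContinuousOn (jointGrad M G) M := by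
  intro p hp
  obtain ⟨K, N, hN, hK⟩ := hM.exists_lipschitzOnWith_jointGrad hG hp
  exact (hK.continuousOn p (mem_of_mem_nhdsWithin hp hN)).mono_of_mem_nhdsWithin hN

/-- `gradOn` represents the derivative within `M` on tangent vectors. -/
theorem inner_gradOn_eq_fderivWithin {φ : EuclideanSpace ℝ (Fin D) → ℝ}
    {w u : EuclideanSpace ℝ (Fin D)} (hu : u ∈ tangentSpaceAt M w) :
    inner ℝ (gradOn M φ w) u = fderivWithin ℝ φ M w u := by
  rw [gradOn, Submodule.inner_starProjection_left_eq_right,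
    Submodule.starProjection_eq_self_iff.2 hu, gradientWithin,
    InnerProductSpace.toDual_symm_apply]

theorem gradOn_mem_tangentSpaceAt (φ : EuclideanSpace ℝ (Fin D) → ℝ)
    (w : EuclideanSpace ℝ (Fin D)) : gradOn M φ w ∈ tangentSpaceAt M w :=
  Submodule.starProjection_apply_mem _ _

/-- The joint flow of commuting gradient fields through a point of `M`. -/
theorem IsSmoothSubmanifold.exists_jointFlow [Fintype ι] (hM : IsSmoothSubmanifold M)
    {G : ι → EuclideanSpace ℝ (Fin D) → ℝ} (hG : ∀ i, ContDiffOn ℝ 2 (G i) M)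
    (hcomm : IsCommutingParam M G) {p : EuclideanSpace ℝ (Fin D)} (hp : p ∈ M) :
    ∃ δ > 0, ∃ Ψ : (ι → ℝ) → EuclideanSpace ℝ (Fin D), Ψ 0 = p ∧ ∀ c, ‖c‖ < δ → Ψ c ∈ M ∧
      HasFDerivAt Ψ (jointGrad M G (Ψ c)) c := by
  obtain ⟨V, U, W, σ, Θ, hpW, h⟩ := hM.exists_isLocalParam hp
  set F : V → (ι → ℝ) →L[ℝ] V := fun v =>
    ∑ i, (ContinuousLinearMap.proj (R := ℝ) (φ := fun _ : ι => ℝ) i).smulRight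
      (IsLocalParam.pullbackGrad σ (G i) v) with hF
  have hFapp : ∀ v c, F v c = ∑ i, c i • IsLocalParam.pullbackGrad σ (G i) v := fun v c => by
    simp [hF]
  have hFC : ContDiffOn ℝ 1 F U := by
    refine ContDiffOn.sum fun i _ => ?_
    exact contDiffOn_const.smulRight (h.contDiffOn_pullbackGrad (hG i))
  have hFd : ∀ v ∈ U, ∀ u e, fderiv ℝ F v u e =
      ∑ i, e i • fderiv ℝ (IsLocalParam.pullbackGrad σ (G i)) v u := by
    intro v hv u e
    have hU := h.isOpen_source.mem_nhds hv
    have h1 : HasFDerivAt F (fderiv ℝ F v) v :=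
      ((hFC.contDiffAt hU).differentiableAt one_ne_zero).hasFDerivAt
    have h2 := h1.clm_apply (hasFDerivAt_const e v)
    have h3 : HasFDerivAt (fun v => F v e)
        (∑ i, e i • fderiv ℝ (IsLocalParam.pullbackGrad σ (G i)) v) v := by
      simp only [hFapp]
      exact HasFDerivAt.fun_sum fun i _ => (((h.contDiffOn_pullbackGrad (hG i)).contDiffAt
        hU).differentiableAt one_ne_zero).hasFDerivAt.const_smul (e i)
    have := congrArg (fun l : V →L[ℝ] V => l u) (h2.unique h3)
    simpa using this
  -- Both sides are double sums over pairs of fields; exchanging the two indices matches them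
  -- termwise by commutation.
  have hint : ∀ v ∈ U, ∀ c e, fderiv ℝ F v (F v c) e = fderiv ℝ F v (F v e) c := by
    intro v hv c e
    rw [hFd v hv, hFd v hv]
    simp only [hFapp, map_sum, map_smul, Finset.smul_sum]
    rw [Finset.sum_comm]
    refine Finset.sum_congr rfl fun i _ => Finset.sum_congr rfl fun j _ => ?_
    rw [h.fderiv_pullbackGrad_comm (hG i) (hG j) hv (hcomm i j _ (h.mapsTo hv).1), smul_comm]
  obtain ⟨δ, hδ, ψ, hψ0, hψ⟩ := exists_hasFDerivAt_of_integrable h.isOpen_source hFC hint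
    (h.mapsTo_inv ⟨hp, hpW⟩)
  refine ⟨δ, hδ, σ ∘ ψ, ?_, fun c hc => ?_⟩
  · rw [Function.comp_apply, hψ0, h.right_inv p ⟨hp, hpW⟩]
  · obtain ⟨hcU, hcd⟩ := hψ c hc
    have hm := (h.mapsTo hcU).1
    refine ⟨hm, ((h.hasFDerivAt hcU).comp c hcd).congr_fderiv ?_⟩
    ext1 e
    simp only [ContinuousLinearMap.comp_apply, hFapp, map_sum, map_smul, jointGrad_apply,
      Function.comp_apply]
    exact Finset.sum_congr rfl fun i _ => by
      rw [h.fderiv_pullbackGrad hcU ((hG i).differentiableOn (by norm_num) _ hm)]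

end FlowBox

/-! ## Curves with integrable controls -/

/-- A mean value inequality relative to a continuous function of time. -/
theorem norm_sub_le_of_eventually_norm_sub_le {X : Type*} [NormedAddCommGroup X]
    {F : ℝ → X} {l : ℝ → ℝ} {a b C : ℝ} (hab : a ≤ b) (hF : ContinuousOn F (Icc a b))
    (hl : ContinuousOn l (Icc a b))
    (h : ∀ s ∈ Ico a b, ∀ᶠ t in 𝓝[>] s, ‖F t - F s‖ ≤ C * (l t - l s)) :
    ‖F b - F a‖ ≤ C * (l b - l a) := by
  have hsub : Icc a b ⊆ {t | ‖F t - F a‖ ≤ C * (l t - l a)} := by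
    -- Continuous induction: the good times form a closed set that extends to the right of each of
    -- its points.
    refine IsClosed.Icc_subset_of_forall_exists_gt ?_ (by simp) ?_
    · rw [inter_comm]
      exact isClosed_Icc.isClosed_le (f := fun t => ‖F t - F a‖) (g := fun t => C * (l t - l a))
        (hF.sub continuousOn_const).norm (continuousOn_const.mul (hl.sub continuousOn_const))
    · rintro s ⟨hs, hsab⟩ y hy
      obtain ⟨t, ht, hty⟩ := ((h s hsab).and (Ioc_mem_nhdsGT hy)).exists
      refine ⟨t, ?_, hty⟩
      have h1 : F t - F a = (F t - F s) + (F s - F a) := by abel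
      have hs' : ‖F s - F a‖ ≤ C * (l s - l a) := hs
      calc ‖F t - F a‖ ≤ ‖F t - F s‖ + ‖F s - F a‖ := by rw [h1]; exact norm_add_le _ _
        _ ≤ C * (l t - l a) := by linarith
  exact hsub (right_mem_Icc.2 hab)

/-- `w` is driven by the control `c` through `Z`: `dw = Z(w) dc`, where the clock `l` dominates
`c`. -/
structure IsDriven {X C : Type*} [NormedAddCommGroup X] [NormedSpace ℝ X]
    [NormedAddCommGroup C] [NormedSpace ℝ C] (Z : X → C →L[ℝ] X) (w : ℝ → X) (c : ℝ → C)
    (l : ℝ → ℝ) : Prop where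
  continuous : Continuous w
  continuous_clock : Continuous l
  monotone_clock : Monotone l
  dominated : ∀ s t, ‖c t - c s‖ ≤ |l t - l s|
  -- Errors are measured by the clock instead of time, so the condition makes sense at every s even
  -- where w and c have no time derivative.
  driven : ∀ ε > 0, ∀ s, ∀ᶠ t in 𝓝 s, ‖w t - w s - Z (w s) (c t - c s)‖ ≤ ε * |l t - l s|

namespace IsDriven

variable {X C : Type*} [NormedAddCommGroup X] [NormedSpace ℝ X]
  [NormedAddCommGroup C] [NormedSpace ℝ C] {Z : X → C →L[ℝ] X} {w : ℝ → X} {c : ℝ → C}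
  {l : ℝ → ℝ}

theorem continuous_control (h : IsDriven Z w c l) : Continuous c := by
  rw [continuous_iff_continuousAt]
  intro s
  rw [ContinuousAt, tendsto_iff_norm_sub_tendsto_zero]
  refine squeeze_zero (fun _ => norm_nonneg _) (fun t => h.dominated s t) ?_
  exact (by have := h.continuous_clock; fun_prop : Continuous fun t => |l t - l s|).tendsto' _ _
    (by simp)

/-- Time reversal. -/
theorem comp_neg (h : IsDriven Z w c l) :
    IsDriven Z (fun t => w (-t)) (fun t => c (-t)) (fun t => -l (-t)) where
  continuous := h.continuous.comp continuous_neg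
  continuous_clock := (h.continuous_clock.comp continuous_neg).neg
  monotone_clock := fun s t hst => neg_le_neg (h.monotone_clock (neg_le_neg hst))
  dominated := fun s t => (h.dominated _ _).trans_eq (by rw [neg_sub_neg, abs_sub_comm])
  driven := fun ε hε s => by
    filter_upwards [(continuous_neg.tendsto s).eventually (h.driven ε hε (-s))] with t ht
    rwa [neg_sub_neg, abs_sub_comm]

/-- A driven curve follows a solution of `DΨ = Z ∘ Ψ` while the Lipschitz constant of `Z` times
the elapsed clock stays below `1 / 2`. -/
theorem eqOn_of_lipschitzOnWith (h : IsDriven Z w c l) {N : Set X} {K : NNReal}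
    (hZ : LipschitzOnWith K Z N) {Ψ : C → X} {a b : ℝ} (hab : a ≤ b)
    (hwN : ∀ t ∈ Icc a b, w t ∈ N) (hΨN : ∀ t ∈ Icc a b, Ψ (c t - c a) ∈ N)
    (hΨ : ∀ t ∈ Icc a b, HasFDerivAt Ψ (Z (Ψ (c t - c a))) (c t - c a)) (h0 : Ψ 0 = w a)
    (hK : K * (l b - l a) ≤ 1 / 2) : ∀ t ∈ Icc a b, w t = Ψ (c t - c a) := by
  set y : ℝ → X := fun t => Ψ (c t - c a) with hy
  have hcont : ContinuousOn (fun t => w t - y t) (Icc a b) := by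
    refine h.continuous.continuousOn.sub fun t ht => ?_
    have hc : ContinuousAt (fun t => c t - c a) t :=
      (h.continuous_control.sub continuous_const).continuousAt
    exact (ContinuousAt.comp (f := fun t => c t - c a) (hΨ t ht).continuousAt
      hc).continuousWithinAt
  obtain ⟨m, hm, hmax⟩ := isCompact_Icc.exists_isMaxOn ⟨a, left_mem_Icc.2 hab⟩ hcont.norm
  -- With e₀ the largest gap, the gap grows at rate at most K * e₀ + 2 * ε relative to the clock.
  -- Since it starts at 0, this gives e₀ ≤ e₀ / 2 + e₀ / 4.
  set e₀ : ℝ := ‖w m - y m‖ with he₀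
  have hle : ∀ t ∈ Icc a b, ‖w t - y t‖ ≤ e₀ := fun t ht => hmax ht
  have hlab : 0 ≤ l b - l a := sub_nonneg.2 (h.monotone_clock hab)
  suffices he : e₀ = 0 by
    intro t ht
    have := hle t ht
    rw [he] at this
    exact sub_eq_zero.1 (norm_le_zero_iff.1 this)
  by_contra hne
  have hpos : 0 < e₀ := lt_of_le_of_ne (norm_nonneg _) (Ne.symm hne)
  obtain ⟨ε, hε, hεl⟩ : ∃ ε > 0, 2 * ε * (l b - l a) ≤ e₀ / 4 := by
    refine ⟨e₀ / (8 * (l b - l a + 1)), by positivity, ?_⟩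
    have : (l b - l a) / (l b - l a + 1) ≤ 1 := by rw [div_le_one (by positivity)]; linarith
    calc 2 * (e₀ / (8 * (l b - l a + 1))) * (l b - l a)
        = e₀ / 4 * ((l b - l a) / (l b - l a + 1)) := by field_simp; ring
      _ ≤ e₀ / 4 * 1 := by gcongr
      _ = e₀ / 4 := mul_one _
  have hloc : ∀ s ∈ Ico a m, ∀ᶠ t in 𝓝[>] s,
      ‖(w t - y t) - (w s - y s)‖ ≤ (K * e₀ + 2 * ε) * (l t - l s) := by
    intro s hs
    have hsab : s ∈ Icc a b := ⟨hs.1, hs.2.le.trans hm.2⟩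
    have hΨs : ∀ᶠ t in 𝓝 s, ‖y t - y s - Z (y s) (c t - c s)‖ ≤ ε * ‖c t - c s‖ := by
      have h1 := (hasFDerivAt_iff_isLittleO.1 (hΨ s hsab)).def hε
      have h2 : Tendsto (fun t => c t - c a) (𝓝 s) (𝓝 (c s - c a)) :=
        (h.continuous_control.sub continuous_const).tendsto s
      filter_upwards [h2.eventually h1] with t ht
      simpa only [sub_sub_sub_cancel_right] using ht
    filter_upwards [nhdsWithin_le_nhds (h.driven ε hε s), nhdsWithin_le_nhds hΨs,
      self_mem_nhdsWithin] with t ht1 ht2 hst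
    have hlst : |l t - l s| = l t - l s := abs_of_nonneg (sub_nonneg.2 (h.monotone_clock hst.le))
    have hcst := h.dominated s t
    rw [hlst] at ht1 hcst
    have hlst0 : 0 ≤ l t - l s := sub_nonneg.2 (h.monotone_clock hst.le)
    have hZs : ‖(Z (w s) - Z (y s)) (c t - c s)‖ ≤ K * e₀ * (l t - l s) := by
      have := hZ.norm_sub_le (hwN s hsab) (hΨN s hsab)
      calc _ ≤ ‖Z (w s) - Z (y s)‖ * ‖c t - c s‖ := ContinuousLinearMap.le_opNorm _ _
        _ ≤ (K * ‖w s - y s‖) * (l t - l s) := by gcongr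
        _ ≤ K * e₀ * (l t - l s) := by gcongr; exact hle s hsab
    have hdec : (w t - y t) - (w s - y s) = (w t - w s - Z (w s) (c t - c s)) -
        (y t - y s - Z (y s) (c t - c s)) + (Z (w s) - Z (y s)) (c t - c s) := by
      rw [sub_apply]; abel
    rw [hdec]
    calc _ ≤ ‖w t - w s - Z (w s) (c t - c s)‖ + ‖y t - y s - Z (y s) (c t - c s)‖ +
          ‖(Z (w s) - Z (y s)) (c t - c s)‖ :=
          (norm_add_le _ _).trans (by gcongr; exact norm_sub_le _ _)
      _ ≤ ε * (l t - l s) + ε * (l t - l s) + K * e₀ * (l t - l s) := by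
          gcongr
          exact ht2.trans (by gcongr)
      _ = (K * e₀ + 2 * ε) * (l t - l s) := by ring
  have hsubm : Icc a m ⊆ Icc a b := Icc_subset_Icc_right hm.2
  have hfin := norm_sub_le_of_eventually_norm_sub_le hm.1 (hcont.mono hsubm)
    h.continuous_clock.continuousOn hloc
  have hwa : w a - y a = 0 := by simp [hy, h0]
  rw [hwa, sub_zero] at hfin
  have hlm : l m - l a ≤ l b - l a := sub_le_sub_right (h.monotone_clock hm.2) _
  have : (K * e₀ + 2 * ε) * (l m - l a) ≤ (K * e₀ + 2 * ε) * (l b - l a) := by gcongr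
  nlinarith

/-- Locally, and in both time directions, a driven curve in `M` follows the solution of
`DΨ = Z ∘ Ψ` through its current point. -/
theorem eventually_eq (h : IsDriven Z w c l) {M N : Set X} {K : NNReal} {t₀ : ℝ}
    (hwM : ∀ t, w t ∈ M) (hN : N ∈ 𝓝[M] (w t₀)) (hZ : LipschitzOnWith K Z N) {Ψ : C → X}
    {δ : ℝ} (hδ : 0 < δ) (h0 : Ψ 0 = w t₀)
    (hΨ : ∀ c, ‖c‖ < δ → Ψ c ∈ M ∧ HasFDerivAt Ψ (Z (Ψ c)) c) :
    ∀ᶠ t in 𝓝 t₀, w t = Ψ (c t - c t₀) := by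
  -- Stated for arbitrary driven curves so that it also applies to the time-reversed one, which
  -- covers the left side of t₀.
  have key : ∀ {w : ℝ → X} {c : ℝ → C} {l : ℝ → ℝ} {t₀ : ℝ}, IsDriven Z w c l →
      (∀ t, w t ∈ M) → N ∈ 𝓝[M] (w t₀) → Ψ 0 = w t₀ →
      ∀ᶠ t in 𝓝[≥] t₀, w t = Ψ (c t - c t₀) := by
    intro w c l t₀ h hwM hN h0
    have hc : Tendsto (fun t => c t - c t₀) (𝓝 t₀) (𝓝 0) :=
      (h.continuous_control.sub continuous_const).tendsto' _ _ (by simp)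
    have hsmall : ∀ᶠ t in 𝓝 t₀, ‖c t - c t₀‖ < δ := by
      filter_upwards [hc.eventually (Metric.ball_mem_nhds 0 hδ)] with t ht
      simpa using ht
    have hw1 : ∀ᶠ t in 𝓝 t₀, w t ∈ N :=
      (tendsto_nhdsWithin_iff.2 ⟨h.continuous.tendsto t₀, Eventually.of_forall hwM⟩).eventually hN
    have hΨ0 : Tendsto (fun t => Ψ (c t - c t₀)) (𝓝 t₀) (𝓝 (w t₀)) := by
      rw [← h0]
      exact (hΨ 0 (by simpa using hδ)).2.continuousAt.tendsto.comp hc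
    have hΨ1 : ∀ᶠ t in 𝓝 t₀, Ψ (c t - c t₀) ∈ N :=
      (tendsto_nhdsWithin_iff.2 ⟨hΨ0, hsmall.mono fun t ht => (hΨ _ ht).1⟩).eventually hN
    have hl : ∀ᶠ t in 𝓝 t₀, K * (l t - l t₀) < 1 / 2 := by
      have : Tendsto (fun t => K * (l t - l t₀)) (𝓝 t₀) (𝓝 0) :=
        (by have := h.continuous_clock; fun_prop :
          Continuous fun t => (K : ℝ) * (l t - l t₀)).tendsto' _ _ (by simp)
      exact this.eventually (gt_mem_nhds (by norm_num))
    obtain ⟨ε, hε, hall⟩ := Metric.eventually_nhds_iff_ball.1 (hsmall.and (hw1.and (hΨ1.and hl)))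
    have hsub : ∀ t ∈ Icc t₀ (t₀ + ε / 2), t ∈ Metric.ball t₀ ε := by
      intro t ht
      rw [Metric.mem_ball, Real.dist_eq, abs_of_nonneg (sub_nonneg.2 ht.1)]
      linarith [ht.2]
    have hab : t₀ ≤ t₀ + ε / 2 := by linarith
    have := h.eqOn_of_lipschitzOnWith hZ hab (fun t ht => (hall t (hsub t ht)).2.1)
      (fun t ht => (hall t (hsub t ht)).2.2.1)
      (fun t ht => (hΨ _ (hall t (hsub t ht)).1).2) h0
      (hall _ (hsub _ (right_mem_Icc.2 hab))).2.2.2.le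
    filter_upwards [Icc_mem_nhdsGE (by linarith : t₀ < t₀ + ε / 2)] with t ht using this t ht
  rw [← nhdsLE_sup_nhdsGE, eventually_sup]
  refine ⟨?_, key h hwM hN h0⟩
  have h1 := key (t₀ := -t₀) h.comp_neg (fun t => hwM _) (by simpa using hN) (by simpa using h0)
  have h2 : Tendsto (fun t : ℝ => -t) (𝓝[≤] t₀) (𝓝[≥] (-t₀)) :=
    tendsto_nhdsWithin_iff.2 ⟨(continuous_neg.tendsto t₀).mono_left nhdsWithin_le_nhds,
      eventually_mem_nhdsWithin.mono fun t ht => mem_Ici.2 (neg_le_neg ht)⟩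
  filter_upwards [h2.eventually h1] with t ht
  simpa using ht

end IsDriven

/-! ## Reachability along driven curves -/

section Reachability

variable {D : ℕ} {ι : Type} [Fintype ι] [DecidableEq ι] {M : Set (EuclideanSpace ℝ (Fin D))}
  {G : ι → EuclideanSpace ℝ (Fin D) → ℝ} {Ψ : (ι → ℝ) → EuclideanSpace ℝ (Fin D)} {δ : ℝ}

/-- Along the line c - s e_i the chain rule turns DΨ = Z ∘ Ψ into the descent equation of the single
component i; convexity keeps the segment in the ball. -/
theorem gradFlowTo_of_jointFlow
    (hΨ : ∀ c, ‖c‖ < δ → Ψ c ∈ M ∧ HasFDerivAt Ψ (jointGrad M G (Ψ c)) c)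
    {c : ι → ℝ} {i : ι} {t : ℝ} (hc : ‖c‖ < δ) (hct : ‖c - Pi.single i t‖ < δ) :
    GradFlowTo M (G i) t (Ψ c) (Ψ (c - Pi.single i t)) := by
  have hsingle : ∀ s : ℝ, (Pi.single i s : ι → ℝ) = s • Pi.single i (1 : ℝ) := fun s => by
    rw [← Pi.single_smul, smul_eq_mul, mul_one]
  refine ⟨fun s => Ψ (c - s • Pi.single i 1), by simp, by rw [hsingle t], fun s hs => ?_⟩
  have hball : c - s • Pi.single i (1 : ℝ) ∈ Metric.ball (0 : ι → ℝ) δ := by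
    have hconv : Convex ℝ ((fun s : ℝ => c - s • (Pi.single i (1 : ℝ) : ι → ℝ)) ⁻¹'
        Metric.ball 0 δ) := by
      intro x hx y hy a b ha hb hab
      have e : c - (a • x + b • y) • (Pi.single i (1 : ℝ) : ι → ℝ) =
          a • (c - x • Pi.single i (1 : ℝ)) + b • (c - y • Pi.single i (1 : ℝ)) := by
        obtain rfl : b = 1 - a := by linarith
        module
      rw [mem_preimage, e]
      exact convex_ball (0 : ι → ℝ) δ hx hy ha hb hab
    have hseg := hconv.ordConnected.uIcc_subset (x := 0) (y := t) (by simpa using hc)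
      (by simpa [← hsingle] using hct)
    exact hseg hs
  obtain ⟨hm, hd⟩ := hΨ _ (by simpa using hball)
  refine ⟨hm, HasDerivAt.hasDerivWithinAt ?_⟩
  have h1 : HasDerivAt (fun s : ℝ => c - s • (Pi.single i (1 : ℝ) : ι → ℝ))
      (-Pi.single i 1) s := by
    simpa using ((hasDerivAt_id s).smul_const (Pi.single i (1 : ℝ) : ι → ℝ)).const_sub c
  have h2 := hd.comp_hasDerivAt s h1
  rw [map_neg, jointGrad_single] at h2
  exact h2

/-- Points of a joint flow are reached from each other with the difference of their times. -/
theorem Reachable.of_jointFlow {w₀ : EuclideanSpace ℝ (Fin D)}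
    (hΨ : ∀ c, ‖c‖ < δ → Ψ c ∈ M ∧ HasFDerivAt Ψ (jointGrad M G (Ψ c)) c)
    {c c₁ c₂ : ι → ℝ} (h₁ : ‖c₁‖ < δ) (h₂ : ‖c₂‖ < δ) (h : Reachable M G w₀ c (Ψ c₁)) :
    Reachable M G w₀ (c + (c₂ - c₁)) (Ψ c₂) := by
  have hδ : 0 < δ := (norm_nonneg _).trans_lt h₁
  -- The coordinates are changed from c₁ to c₂ one at a time. The sup norm keeps all mixed points in
  -- the ball.
  have hS : ∀ S : Finset ι, ‖S.piecewise c₂ c₁‖ < δ := by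
    intro S
    rw [pi_norm_lt_iff hδ] at h₁ h₂ ⊢
    intro i
    by_cases hi : i ∈ S
    · rw [Finset.piecewise_eq_of_mem _ _ _ hi]; exact h₂ i
    · rw [Finset.piecewise_eq_of_notMem _ _ _ hi]; exact h₁ i
  have key : ∀ S : Finset ι,
      Reachable M G w₀ (c + (S.piecewise c₂ c₁ - c₁)) (Ψ (S.piecewise c₂ c₁)) := by
    intro S
    induction S using Finset.induction_on with
    | empty => simpa using h
    | insert i S hi ih =>
      have e : (insert i S).piecewise c₂ c₁ =
          S.piecewise c₂ c₁ - Pi.single i (c₁ i - c₂ i) := by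
        rw [Finset.piecewise_insert]
        ext j
        by_cases hj : j = i
        · subst hj
          simp [Finset.piecewise_eq_of_notMem _ _ _ hi]
        · simp [hj]
      have hS' := hS (insert i S)
      rw [e] at hS' ⊢
      have := Reachable.step i (c₁ i - c₂ i) ih (gradFlowTo_of_jointFlow hΨ (hS S) hS')
      convert this using 1
      abel
  simpa using key Finset.univ

/-- Along a curve driven by commuting gradient fields, the control gives the flow times. -/
theorem IsDriven.reachable (hM : IsSmoothSubmanifold M) (hG : ∀ i, ContDiffOn ℝ 2 (G i) M)
    (hcomm : IsCommutingParam M G) {w : ℝ → EuclideanSpace ℝ (Fin D)} {c : ℝ → ι → ℝ} {l : ℝ → ℝ}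
    (h : IsDriven (jointGrad M G) w c l) (hwM : ∀ t, w t ∈ M) {w₀ : EuclideanSpace ℝ (Fin D)}
    {s : ℝ} (hs : Reachable M G w₀ (c s) (w s)) (t : ℝ) : Reachable M G w₀ (c t) (w t) := by
  -- Joint flows can be traversed both ways; the equivalence makes the set of reachable times closed
  -- as well as open.
  have hloc : ∀ t₀, ∀ᶠ t in 𝓝 t₀,
      (Reachable M G w₀ (c t) (w t) ↔ Reachable M G w₀ (c t₀) (w t₀)) := by
    intro t₀
    obtain ⟨δ, hδ, Ψ, hΨ0, hΨ⟩ := hM.exists_jointFlow hG hcomm (hwM t₀)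
    obtain ⟨K, N, hN, hK⟩ := hM.exists_lipschitzOnWith_jointGrad hG (hwM t₀)
    have hc : Tendsto (fun t => c t - c t₀) (𝓝 t₀) (𝓝 0) :=
      (h.continuous_control.sub continuous_const).tendsto' _ _ (by simp)
    filter_upwards [h.eventually_eq hwM hN hK hδ hΨ0 hΨ,
      hc.eventually (Metric.ball_mem_nhds 0 hδ)] with t ht hct
    rw [dist_zero_right] at hct
    have h0 : ‖(0 : ι → ℝ)‖ < δ := by simpa using hδ
    rw [ht, ← hΨ0]
    constructor
    · intro hr
      simpa using hr.of_jointFlow hΨ hct h0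
    · intro hr
      simpa using hr.of_jointFlow hΨ h0 hct
  have hclopen : IsClopen {t | Reachable M G w₀ (c t) (w t)} := by
    refine ⟨⟨isOpen_iff_mem_nhds.2 fun t₀ ht₀ => ?_⟩, isOpen_iff_mem_nhds.2 fun t₀ ht₀ => ?_⟩
    · filter_upwards [hloc t₀] with t ht using fun hr => ht₀ (ht.1 hr)
    · filter_upwards [hloc t₀] with t ht using ht.2 ht₀
  exact (hclopen.eq_univ ⟨s, hs⟩).ge (mem_univ t)

end Reachability

/-- The clock is the total variation ∫ ‖u‖. Freezing the coefficient at time s costs little, because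
Z (w r) is continuous in r, however irregular u is. -/
theorem IsDriven.of_integral {X C : Type*} [NormedAddCommGroup X] [NormedSpace ℝ X]
    [CompleteSpace X] [NormedAddCommGroup C] [NormedSpace ℝ C] [CompleteSpace C]
    {Z : X → C →L[ℝ] X} {w : ℝ → X} {u : ℝ → C}
    (hu : ∀ a b, IntervalIntegrable u volume a b) (hZ : Continuous fun r => Z (w r))
    (hZu : ∀ a b, IntervalIntegrable (fun r => Z (w r) (u r)) volume a b)
    (hw : ∀ t, w t = w 0 + ∫ r in (0 : ℝ)..t, Z (w r) (u r)) :
    IsDriven Z w (fun t => ∫ r in (0 : ℝ)..t, u r) (fun t => ∫ r in (0 : ℝ)..t, ‖u r‖) := by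
  have hsubl : ∀ s t, (∫ r in (0 : ℝ)..t, ‖u r‖) - ∫ r in (0 : ℝ)..s, ‖u r‖ =
      ∫ r in s..t, ‖u r‖ := fun s t =>
    intervalIntegral.integral_interval_sub_left (hu _ _).norm (hu _ _).norm
  have hsubc : ∀ s t, (∫ r in (0 : ℝ)..t, u r) - ∫ r in (0 : ℝ)..s, u r =
      ∫ r in s..t, u r := fun s t =>
    intervalIntegral.integral_interval_sub_left (hu _ _) (hu _ _)
  refine ⟨?_, intervalIntegral.continuous_primitive (fun a b => (hu a b).norm) 0, ?_, ?_, ?_⟩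
  · have := (intervalIntegral.continuous_primitive hZu 0).const_add (w 0)
    exact this.congr fun t => (hw t).symm
  · intro s t hst
    have := intervalIntegral.integral_nonneg (μ := volume) hst fun r _ => norm_nonneg (u r)
    have h2 := hsubl s t
    simp only
    linarith
  · intro s t
    rw [hsubc, hsubl]
    exact intervalIntegral.norm_integral_le_abs_integral_norm
  · intro ε hε s
    have hcont := Metric.continuousAt_iff.1 (hZ.continuousAt (x := s)) ε hε
    obtain ⟨ρ, hρ, hclose⟩ := hcont
    filter_upwards [Metric.ball_mem_nhds s hρ] with t ht
    have hwst : w t - w s = ∫ r in s..t, Z (w r) (u r) := by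
      rw [hw t, hw s, add_sub_add_left_eq_sub]
      exact intervalIntegral.integral_interval_sub_left (hZu _ _) (hZu _ _)
    have hconst : IntervalIntegrable (fun r => Z (w s) (u r)) volume s t :=
      ⟨(Z (w s)).integrable_comp (hu s t).1, (Z (w s)).integrable_comp (hu s t).2⟩
    rw [hsubc, hsubl, hwst, ← (Z (w s)).intervalIntegral_comp_comm (hu s t),
      ← intervalIntegral.integral_sub (hZu s t) hconst]
    have hb : ‖∫ r in s..t, (Z (w r) (u r) - Z (w s) (u r))‖ ≤ |∫ r in s..t, ε * ‖u r‖| := by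
      refine intervalIntegral.norm_integral_le_abs_of_norm_le ?_ ((hu s t).norm.const_mul ε)
      refine ae_restrict_of_forall_mem measurableSet_uIoc fun r hr => ?_
      have hrs : dist r s < ρ := by
        have h1 := abs_sub_left_of_mem_uIcc (uIoc_subset_uIcc hr)
        rw [Metric.mem_ball, Real.dist_eq] at ht
        rw [Real.dist_eq]
        exact h1.trans_lt ht
      rw [← sub_apply]
      refine (ContinuousLinearMap.le_opNorm _ _).trans ?_
      gcongr
      rw [← dist_eq_norm]
      exact (hclose hrs).le
    rwa [intervalIntegral.integral_const_mul, abs_mul, abs_of_pos hε] at hb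

/-! ### Gradients on M as representing vectors -/

section Gradients

variable {D n : ℕ} {M : Set (EuclideanSpace ℝ (Fin D))}

theorem inner_gradOn {φ : EuclideanSpace ℝ (Fin D) → ℝ} {w u : EuclideanSpace ℝ (Fin D)}
    {φ' : EuclideanSpace ℝ (Fin D) →L[ℝ] ℝ} (hφ : HasFDerivWithinAt φ φ' M w)
    (hu : u ∈ tangentSpaceAt M w) : inner ℝ (gradOn M φ w) u = φ' u := by
  rw [inner_gradOn_eq_fderivWithin hu]
  exact LinearMap.eqOn_span (f := (fderivWithin ℝ φ M w : EuclideanSpace ℝ (Fin D) →ₗ[ℝ] ℝ))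
    (g := (φ' : EuclideanSpace ℝ (Fin D) →ₗ[ℝ] ℝ))
    (HasFDerivWithinAt.unique_on hφ.differentiableWithinAt.hasFDerivWithinAt hφ) hu

/-- The chain rule for gradients on `M`. -/
theorem gradOn_comp {g : EuclideanSpace ℝ (Fin D) → EuclideanSpace ℝ (Fin n)}
    {f : EuclideanSpace ℝ (Fin n) → ℝ} {w : EuclideanSpace ℝ (Fin D)}
    (hg : DifferentiableWithinAt ℝ g M w) (hf : DifferentiableAt ℝ f (g w)) :
    gradOn M (f ∘ g) w = ∑ i, gradient f (g w) i • gradOn M (fun w => g w i) w := by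
  have hgi : ∀ i, HasFDerivWithinAt (fun w => g w i)
      ((EuclideanSpace.proj i : EuclideanSpace ℝ (Fin n) →L[ℝ] ℝ) ∘L fderivWithin ℝ g M w) M w :=
    fun i => (EuclideanSpace.proj i : EuclideanSpace ℝ (Fin n) →L[ℝ] ℝ).hasFDerivAt.comp_hasFDerivWithinAt
      w hg.hasFDerivWithinAt
  have hfg := hf.hasGradientAt.hasFDerivAt.comp_hasFDerivWithinAt w hg.hasFDerivWithinAt
  have hmem : gradOn M (f ∘ g) w - ∑ i, gradient f (g w) i • gradOn M (fun w => g w i) w ∈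
      tangentSpaceAt M w :=
    Submodule.sub_mem _ (gradOn_mem_tangentSpaceAt _ _) (Submodule.sum_mem _ fun i _ =>
      Submodule.smul_mem _ _ (gradOn_mem_tangentSpaceAt _ _))
  -- The difference of the two sides is tangent, so the representing property may be tested on the
  -- difference itself.
  refine sub_eq_zero.1 (inner_self_eq_zero (𝕜 := ℝ).1 ?_)
  generalize hd : gradOn M (f ∘ g) w -
    ∑ i, gradient f (g w) i • gradOn M (fun w => g w i) w = d at hmem ⊢
  nth_rewrite 1 [← hd]
  rw [inner_sub_left, sum_inner, inner_gradOn hfg hmem, sub_eq_zero]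
  simp only [inner_smul_left, inner_gradOn (hgi _) hmem, ContinuousLinearMap.comp_apply,
    InnerProductSpace.toDual_apply_apply, PiLp.inner_apply, conj_trivial]
  exact Finset.sum_congr rfl fun i _ => by simp [mul_comm]

end Gradients

/-! ## The regularized gradient flow -/

section RegularizedFlow

variable {D n : ℕ} {M : Set (EuclideanSpace ℝ (Fin D))}
  {g : EuclideanSpace ℝ (Fin D) → EuclideanSpace ℝ (Fin n)} {h : EuclideanSpace ℝ (Fin D) → ℝ}
  {f : EuclideanSpace ℝ (Fin n) → ℝ} {α : ℝ → ℝ} {w₀ : EuclideanSpace ℝ (Fin D)}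
  {w : ℝ → EuclideanSpace ℝ (Fin D)}

theorem contDiffOn_jointComponents (hg : ContDiffOn ℝ 2 g M) (hh : ContDiffOn ℝ 2 h M) :
    ∀ i, ContDiffOn ℝ 2 (jointComponents g h i) M
  | some i => (EuclideanSpace.proj i : EuclideanSpace ℝ (Fin n) →L[ℝ] ℝ).contDiff.comp_contDiffOn hg
  | none => hh

/-- The rates at which the flow times of the components of `(g, h)` accrue along the regularized
gradient flow. It is extended by `0` to negative times. -/
noncomputable def flowRate (g : EuclideanSpace ℝ (Fin D) → EuclideanSpace ℝ (Fin n))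
    (f : EuclideanSpace ℝ (Fin n) → ℝ) (α : ℝ → ℝ) (w : ℝ → EuclideanSpace ℝ (Fin D)) (r : ℝ) :
    Option (Fin n) → ℝ
  | some i => if 0 < r then -gradient f (g (w r)) i else 0
  | none => if 0 < r then -α r else 0

theorem flowRate_of_nonpos {r : ℝ} (hr : r ≤ 0) : flowRate g f α w r = 0 := by
  ext i
  cases i <;> simp [flowRate, hr.not_gt]

theorem jointGrad_flowRate (hg : ContDiffOn ℝ 2 g M) (hf : ContDiff ℝ 1 f) {r : ℝ} (hr : 0 < r)
    (hw : w r ∈ M) :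
    jointGrad M (jointComponents g h) (w r) (flowRate g f α w r) =
      -(gradOn M (f ∘ g) (w r) + α r • gradOn M h (w r)) := by
  rw [jointGrad_apply, Fintype.sum_option,
    gradOn_comp (hg.differentiableOn (by norm_num) _ hw) (hf.differentiable one_ne_zero _)]
  simp only [flowRate, hr, if_true, jointComponents, neg_smul, Finset.sum_neg_distrib]
  abel

/-- A function that vanishes for nonpositive times is interval integrable
if it is so for positive times. -/
theorem intervalIntegrable_of_nonneg {X : Type*} [NormedAddCommGroup X] {F : ℝ → X}
    (h0 : ∀ r ≤ 0, F r = 0) (hF : ∀ t, 0 ≤ t → IntervalIntegrable F volume 0 t) (a b : ℝ) :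
    IntervalIntegrable F volume a b := by
  have key : ∀ t, IntervalIntegrable F volume 0 t := by
    intro t
    rcases le_total 0 t with ht | ht
    · exact hF t ht
    · refine IntervalIntegrable.congr (f := fun _ => 0) (fun r hr => ?_) intervalIntegrable_const
      rw [uIoc_of_ge ht] at hr
      exact (h0 r hr.2).symm
  exact (key a).symm.trans (key b)


theorem intervalIntegrable_flowRate_apply (hg : ContDiffOn ℝ 2 g M) (hf : ContDiff ℝ 1 f)
    (hα : ∀ t, 0 ≤ t → IntervalIntegrable α volume 0 t) (hwc : Continuous w) (hwM : ∀ t, w t ∈ M)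
    (i : Option (Fin n)) (a b : ℝ) :
    IntervalIntegrable (fun r => flowRate g f α w r i) volume a b := by
  refine intervalIntegrable_of_nonneg (fun r hr => by rw [flowRate_of_nonpos hr]; rfl)
    (fun t ht => ?_) a b
  cases i with
  | some i =>
    have hc : Continuous fun r => -gradient f (g (w r)) i := by
      have := (continuous_gradient hf).comp (hg.continuousOn.comp_continuous hwc hwM)
      exact ((EuclideanSpace.proj i : EuclideanSpace ℝ (Fin n) →L[ℝ] ℝ).continuous.comp this).neg
    refine (hc.intervalIntegrable 0 t).congr fun r hr => ?_
    rw [uIoc_of_le ht] at hr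
    simp [flowRate, hr.1]
  | none =>
    refine (hα t ht).neg.congr fun r hr => ?_
    rw [uIoc_of_le ht] at hr
    simp [flowRate, hr.1]

theorem intervalIntegrable_flowRate (hg : ContDiffOn ℝ 2 g M) (hf : ContDiff ℝ 1 f)
    (hα : ∀ t, 0 ≤ t → IntervalIntegrable α volume 0 t) (hwc : Continuous w) (hwM : ∀ t, w t ∈ M)
    (a b : ℝ) : IntervalIntegrable (flowRate g f α w) volume a b :=
  ⟨Integrable.of_eval fun i => (intervalIntegrable_flowRate_apply hg hf hα hwc hwM i a b).1,
    Integrable.of_eval fun i => (intervalIntegrable_flowRate_apply hg hf hα hwc hwM i a b).2⟩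

theorem intervalIntegrable_jointGrad_flowRate (hM : IsSmoothSubmanifold M)
    (hg : ContDiffOn ℝ 2 g M) (hh : ContDiffOn ℝ 2 h M) (hf : ContDiff ℝ 1 f)
    (hα : ∀ t, 0 ≤ t → IntervalIntegrable α volume 0 t) (hwc : Continuous w) (hwM : ∀ t, w t ∈ M)
    (a b : ℝ) : IntervalIntegrable
      (fun r => jointGrad M (jointComponents g h) (w r) (flowRate g f α w r)) volume a b := by
  have hZ : Continuous fun r => jointGrad M (jointComponents g h) (w r) :=
    (hM.continuousOn_jointGrad (contDiffOn_jointComponents hg hh)).comp_continuous hwc hwM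
  -- Splitting by components leaves integrable scalars times continuous vector fields.
  have hsum : (fun r => jointGrad M (jointComponents g h) (w r) (flowRate g f α w r)) =
      ∑ i, fun r => flowRate g f α w r i •
        jointGrad M (jointComponents g h) (w r) (Pi.single i 1) := by
    ext1 r
    simp only [jointGrad_single, Finset.sum_apply]
    rw [jointGrad_apply]
  rw [hsum]
  exact IntervalIntegrable.sum _ fun i _ =>
    (intervalIntegrable_flowRate_apply hg hf hα hwc hwM i a b).smul_continuousOn
      (hZ.clm_apply continuous_const).continuousOn

/-- The regularized gradient flow, stopped at negative times, in terms of the flow rates. -/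
theorem IsRegularizedGradientFlow.eq_integral_flowRate (hg : ContDiffOn ℝ 2 g M)
    (hf : ContDiff ℝ 1 f) (hw : IsRegularizedGradientFlow M g h f α w₀ w) (t : ℝ) :
    w (max t 0) = w₀ + ∫ r in (0 : ℝ)..t, jointGrad M (jointComponents g h) (w (max r 0))
      (flowRate g f α (fun r => w (max r 0)) r) := by
  rcases le_total 0 t with ht | ht
  · rw [max_eq_left ht, hw.2.2 t ht, sub_eq_add_neg, ← intervalIntegral.integral_neg]
    congr 1
    refine intervalIntegral.integral_congr_ae (Eventually.of_forall fun r hr => ?_)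
    rw [uIoc_of_le ht] at hr
    have := jointGrad_flowRate (h := h) (α := α) (w := fun r => w (max r 0)) hg hf hr.1
      (hw.2.1 _ (le_max_right _ _))
    simp only [max_eq_left hr.1.le] at this ⊢
    rw [this]
  · have h0 : w 0 = w₀ := by simpa using hw.2.2 0 le_rfl
    rw [max_eq_right ht, h0]
    have : ∫ r in (0 : ℝ)..t, jointGrad M (jointComponents g h) (w (max r 0))
        (flowRate g f α (fun r => w (max r 0)) r) = ∫ r in (0 : ℝ)..t, 0 := by
      refine intervalIntegral.integral_congr_ae (Eventually.of_forall fun r hr => ?_)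
      rw [uIoc_of_ge ht] at hr
      rw [flowRate_of_nonpos hr.2, map_zero]
    simp [this]

theorem IsRegularizedGradientFlow.continuous_stopped
    (hw : IsRegularizedGradientFlow M g h f α w₀ w) : Continuous fun t => w (max t 0) :=
  hw.1.comp_continuous (by fun_prop) fun _ => mem_Ici.2 (le_max_right _ _)

theorem IsRegularizedGradientFlow.stopped_mem
    (hw : IsRegularizedGradientFlow M g h f α w₀ w) (t : ℝ) : w (max t 0) ∈ M :=
  hw.2.1 _ (le_max_right _ _)

/-- The regularized gradient flow is reached by the flows of the components. -/
theorem IsRegularizedGradientFlow.reachable (hM : IsSmoothSubmanifold M)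
    (hg : ContDiffOn ℝ 2 g M) (hh : ContDiffOn ℝ 2 h M)
    (hcomm : IsCommutingParam M (jointComponents g h)) (hf : ContDiff ℝ 1 f)
    (hα : ∀ t, 0 ≤ t → IntervalIntegrable α volume 0 t)
    (hw : IsRegularizedGradientFlow M g h f α w₀ w) (t : ℝ) :
    Reachable M (jointComponents g h) w₀
      (∫ r in (0 : ℝ)..t, flowRate g f α (fun r => w (max r 0)) r) (w (max t 0)) := by
  have hwc := hw.continuous_stopped
  have hwM := hw.stopped_mem
  have hG := contDiffOn_jointComponents hg hh
  have h0 : w (max 0 0) = w₀ := by simpa using hw.2.2 0 le_rfl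
  have hdr := IsDriven.of_integral (Z := jointGrad M (jointComponents g h))
    (w := fun r => w (max r 0)) (intervalIntegrable_flowRate hg hf hα hwc hwM)
    ((hM.continuousOn_jointGrad hG).comp_continuous hwc hwM)
    (intervalIntegrable_jointGrad_flowRate hM hg hh hf hα hwc hwM)
    (fun t => by rw [h0]; exact hw.eq_integral_flowRate hg hf t)
  refine hdr.reachable hM hG hcomm hwM (s := 0) ?_ t
  rw [h0]
  simpa using Reachable.start

theorem integral_flowRate_none (hg : ContDiffOn ℝ 2 g M) (hf : ContDiff ℝ 1 f)
    (hα : ∀ t, 0 ≤ t → IntervalIntegrable α volume 0 t) (hwc : Continuous w) (hwM : ∀ t, w t ∈ M)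
    {t : ℝ} (ht : 0 ≤ t) :
    (∫ r in (0 : ℝ)..t, flowRate g f α w r) none = accumReg α t := by
  have := (ContinuousLinearMap.proj (R := ℝ) (φ := fun _ : Option (Fin n) => ℝ)
    none).intervalIntegral_comp_comm (intervalIntegrable_flowRate hg hf hα hwc hwM 0 t)
  rw [ContinuousLinearMap.proj_apply] at this
  rw [← this, accumReg, ← intervalIntegral.integral_neg]
  refine intervalIntegral.integral_congr_ae (Eventually.of_forall fun r hr => ?_)
  rw [uIoc_of_le ht] at hr
  simp [flowRate, hr.1]

theorem integral_flowRate_some (hg : ContDiffOn ℝ 2 g M) (hf : ContDiff ℝ 1 f)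
    (hα : ∀ t, 0 ≤ t → IntervalIntegrable α volume 0 t) (hwc : Continuous w) (hwM : ∀ t, w t ∈ M)
    {t : ℝ} (ht : 0 ≤ t) :
    WithLp.toLp 2 (fun i => (∫ r in (0 : ℝ)..t, flowRate g f α w r) (some i)) =
      ∫ r in (0 : ℝ)..t, -gradient f (g (w r)) := by
  have hc : Continuous fun r => -gradient f (g (w r)) :=
    ((continuous_gradient hf).comp (hg.continuousOn.comp_continuous hwc hwM)).neg
  ext i
  have h1 := (ContinuousLinearMap.proj (R := ℝ) (φ := fun _ : Option (Fin n) => ℝ)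
    (some i)).intervalIntegral_comp_comm (intervalIntegrable_flowRate hg hf hα hwc hwM 0 t)
  have h2 := (EuclideanSpace.proj i : EuclideanSpace ℝ (Fin n) →L[ℝ] ℝ).intervalIntegral_comp_comm
    (hc.intervalIntegrable (μ := volume) 0 t)
  rw [ContinuousLinearMap.proj_apply] at h1
  refine h1.symm.trans (Eq.trans ?_ h2)
  refine intervalIntegral.integral_congr_ae (Eventually.of_forall fun r hr => ?_)
  rw [uIoc_of_le ht] at hr
  simp [flowRate, hr.1]

/-- Where the regularization is switched off, the flow is the gradient flow of the loss. -/
theorem IsRegularizedGradientFlow.hasDerivAt (hM : IsSmoothSubmanifold M)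
    (hg : ContDiffOn ℝ 2 g M) (hh : ContDiffOn ℝ 2 h M) (hf : ContDiff ℝ 1 f)
    (hα : ∀ t, 0 ≤ t → IntervalIntegrable α volume 0 t)
    (hw : IsRegularizedGradientFlow M g h f α w₀ w) {T : ℝ} (hT : 0 ≤ T)
    (hαT : ∀ t, T ≤ t → α t = 0) {t : ℝ} (ht : T < t) :
    HasDerivAt (fun t => w (max t 0)) (-gradOn M (f ∘ g) (w (max t 0))) t := by
  have hwc := hw.continuous_stopped
  have hwM := hw.stopped_mem
  have hint := intervalIntegrable_jointGrad_flowRate hM hg hh hf hα hwc hwM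
  -- The loss f ∘ g is only known to be C¹, so continuity comes from the chain rule and the
  -- gradients of the C² components.
  have hQ : Continuous fun r => -gradOn M (f ∘ g) (w (max r 0)) := by
    have hgw : Continuous fun r => g (w (max r 0)) := hg.continuousOn.comp_continuous hwc hwM
    have hgi : ∀ i, Continuous fun r => gradOn M (fun w => g w i) (w (max r 0)) := fun i => by
      have := (hM.continuousOn_jointGrad (contDiffOn_jointComponents hg hh)).comp_continuous hwc hwM
      refine (this.clm_apply (continuous_const (y := Pi.single (some i) 1))).congr fun r => ?_
      exact jointGrad_single _ _ _
    refine Continuous.neg (Continuous.congr ?_ fun r => (gradOn_comp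
      (hg.differentiableOn (by norm_num) _ (hwM r)) (hf.differentiable one_ne_zero _)).symm)
    refine continuous_finsetSum _ fun i _ => Continuous.fun_smul ?_ (hgi i)
    exact (EuclideanSpace.proj i : EuclideanSpace ℝ (Fin n) →L[ℝ] ℝ).continuous.comp
      ((continuous_gradient hf).comp hgw)
  have hder := ((hQ.integral_hasStrictDerivAt T t).hasDerivAt).const_add (w (max T 0))
  refine hder.congr_of_eventuallyEq ?_
  filter_upwards [lt_mem_nhds ht] with τ hτ
  rw [hw.eq_integral_flowRate hg hf τ, hw.eq_integral_flowRate hg hf T, add_assoc,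
    ← intervalIntegral.integral_add_adjacent_intervals (hint 0 T) (hint T τ)]
  congr 2
  refine intervalIntegral.integral_congr_ae (Eventually.of_forall fun r hr => ?_)
  rw [uIoc_of_le hτ.le] at hr
  have := jointGrad_flowRate (h := h) (α := α) (w := fun r => w (max r 0)) hg hf
    (hT.trans_lt hr.1) (hwM r)
  simpa [hαT r hr.1.le] using this

end RegularizedFlow

/-! ### The accumulated regularization and the main theorem -/

theorem accumReg_nonpos {α : ℝ → ℝ} (hα : ∀ t, 0 ≤ t → 0 ≤ α t) {t : ℝ} (ht : 0 ≤ t) :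
    accumReg α t ≤ 0 :=
  neg_nonpos.2 (intervalIntegral.integral_nonneg ht fun r hr => hα r hr.1)

theorem accumReg_eq_of_le {α : ℝ → ℝ} (hα : ∀ t, 0 ≤ t → IntervalIntegrable α volume 0 t)
    {T : ℝ} (hT : 0 ≤ T) (hαT : ∀ t, T ≤ t → α t = 0) {t : ℝ} (ht : T ≤ t) :
    accumReg α t = accumReg α T := by
  have h1 := intervalIntegral.integral_interval_sub_left (hα t (hT.trans ht)) (hα T hT)
  have h2 : ∫ r in T..t, α r = ∫ r in T..t, 0 :=
    intervalIntegral.integral_congr fun r hr => hαT r (by rw [uIcc_of_le ht] at hr; exact hr.1)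
  rw [h2, intervalIntegral.integral_zero] at h1
  rw [accumReg, accumReg, sub_eq_zero.1 h1]

theorem theorem3p2 {D n : ℕ}
    -- the setting: the manifold, the parameterization `g` and the regularizer `h`
    (M : Set (EuclideanSpace ℝ (Fin D))) (hM : IsSmoothSubmanifold M)
    (g : EuclideanSpace ℝ (Fin D) → EuclideanSpace ℝ (Fin n))
    (h : EuclideanSpace ℝ (Fin D) → ℝ)
    (hg : ContDiffOn ℝ 2 g M) (hh : ContDiffOn ℝ 2 h M)
    (hreg : IsRegularParam M (jointComponents g h))
    (hcomm : IsCommutingParam M (jointComponents g h))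
    (hflows : FlowsWellDefined M (jointComponents g h))
    (w₀ : EuclideanSpace ℝ (Fin D)) (hw₀ : w₀ ∈ M)
    -- the regularization schedule
    (α : ℝ → ℝ) (hαint : ∀ t, 0 ≤ t → IntervalIntegrable α volume 0 t)
    (hαnonneg : ∀ t, 0 ≤ t → 0 ≤ α t)
    (T : ℝ) (hT : 0 < T) (hαT : ∀ t, T ≤ t → α t = 0)
    (b : ℝ) (hb : b < 0) (hab : ∀ t, 0 ≤ t → b ≤ accumReg α t)
    (aInf : ℝ) (haInf : Tendsto (accumReg α) atTop (𝓝 aInf))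
    -- the time-dependent Legendre function, a contracting Bregman function
    (R : ℝ → EuclideanSpace ℝ (Fin n) → WithTop ℝ)
    (hR : IsTimeDepLegendreOf M g h w₀ (Icc b 0) R)
    (hBreg : ∀ a ∈ Icc b 0, IsBregman (R a))
    (hcontr : IsContracting R (Icc b 0))
    -- the loss function
    (f : EuclideanSpace ℝ (Fin n) → ℝ) (hf : ContDiff ℝ 1 f)
    (hfLip : LocallyLipschitz (gradient f))
    (hargmin : ∃ x ∈ effDom (R aInf), IsMinOn f (effDom (R aInf)) x)
    -- the gradient flow
    (w : ℝ → EuclideanSpace ℝ (Fin D))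
    (hw : IsRegularizedGradientFlow M g h f α w₀ w) :
    (QuasiconvexOn ℝ univ f →
      ∃ xs ∈ effDom (R aInf), Tendsto (fun t => g (w t)) atTop (𝓝 xs) ∧
        ∀ x ∈ effDom (R aInf), 0 ≤ inner ℝ (gradient f xs) (x - xs)) ∧
    (ConvexOn ℝ univ f →
      ∃ xs ∈ closure (effDom (R aInf)), Tendsto (fun t => g (w t)) atTop (𝓝 xs) ∧
        IsMinOn f (closure (effDom (R aInf))) xs) := by

  have hT0 : 0 ≤ T := hT.le
  have haT : ∀ t, T ≤ t → accumReg α t = aInf := by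
    have heq : aInf = accumReg α T := tendsto_nhds_unique haInf
      (tendsto_const_nhds.congr' ((eventually_ge_atTop T).mono fun t ht =>
        (accumReg_eq_of_le hαint hT0 hαT ht).symm))
    exact fun t ht => (accumReg_eq_of_le hαint hT0 hαT ht).trans heq.symm
  have haInfmem : aInf ∈ Icc b 0 := by
    rw [← haT T le_rfl]
    exact ⟨hab T hT0, accumReg_nonpos hαnonneg hT0⟩
  have hB := hBreg aInf haInfmem
  -- Frozen at negative times, because driven curves are indexed by all of ℝ.
  set W : ℝ → EuclideanSpace ℝ (Fin D) := fun t => w (max t 0) with hW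
  have hWc : Continuous W := hw.continuous_stopped
  have hWM : ∀ t, W t ∈ M := hw.stopped_mem
  -- The index none of the flow times is a_t, which equals a_∞ from T on; the remaining entries are
  -- the dual variable.
  have hmirror : ∀ t, T ≤ t → g (W t) ∈ interior (effDom (R aInf)) ∧
      gradFin (R aInf) (g (W t)) = ∫ r in (0 : ℝ)..t, -gradient f (g (W r)) := by
    intro t ht
    have ht0 := hT0.trans ht
    have hnone := integral_flowRate_none hg hf hαint hWc hWM ht0
    rw [haT t ht] at hnone
    have := hR.2 _ _ (hw.reachable hM hg hh hcomm hf hαint t) (by rw [hnone]; exact haInfmem)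
    rw [hnone] at this
    exact ⟨this.1, this.2.trans (integral_flowRate_some hg hf hαint hWc hWM ht0)⟩
  have hgradc : Continuous fun r => -gradient f (g (W r)) :=
    ((continuous_gradient hf).comp (hg.continuousOn.comp_continuous hWc hWM)).neg
  -- The mirror flow is started at T + 1 because a two-sided derivative is needed at the starting
  -- time, and α may jump at T.
  have hWd : ∀ t, T + 1 ≤ t → HasDerivAt W (-gradOn M (f ∘ g) (W t)) t := fun t ht =>
    hw.hasDerivAt hM hg hh hf hαint hT0 hαT (by linarith)
  have hgd : ∀ t, HasFDerivWithinAt g (fderivWithin ℝ g M (W t)) M (W t) := fun t =>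
    (hg.differentiableOn (by norm_num) _ (hWM t)).hasFDerivWithinAt
  have hloss : ∀ t, T + 1 ≤ t → HasDerivAt (fun t => f (g (W t)))
      (-inner ℝ (gradOn M (f ∘ g) (W t)) (gradOn M (f ∘ g) (W t))) t := by
    intro t ht
    have hfg := (hf.differentiable one_ne_zero (g (W t))).hasFDerivAt.comp_hasFDerivWithinAt
      (W t) (hgd t)
    have h1 := hfg.comp_hasDerivAt t (hWd t ht) (Eventually.of_forall hWM)
    rw [map_neg, ← inner_gradOn hfg (gradOn_mem_tangentSpaceAt _ _)] at h1
    exact h1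
  have hanti : AntitoneOn (fun t => f (g (W t))) (Ici (T + 1)) := by
    refine antitoneOn_of_deriv_nonpos (convex_Ici _)
      (fun t ht => (hloss t ht).continuousAt.continuousWithinAt)
      (fun t ht => (hloss t (interior_subset ht)).differentiableAt.differentiableWithinAt)
      fun t ht => ?_
    rw [(hloss t (interior_subset ht)).deriv]
    exact neg_nonpos.2 real_inner_self_nonneg
  have hquasi : QuasiconvexOn ℝ univ f →
      ∃ xs ∈ effDom (R aInf), Tendsto (fun t => g (w t)) atTop (𝓝 xs) ∧
        ∀ x ∈ effDom (R aInf), 0 ≤ inner ℝ (gradient f xs) (x - xs) := by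
    intro hq
    obtain ⟨xs, hxs, hlim, hvar⟩ := mirrorFlow_tendsto hB hf hq hargmin
      (x := fun t => g (W t)) (t₀ := T + 1)
      (fun t ht => (hmirror t (by linarith)).1) (fun t ht => (hmirror t (by linarith)).2)
      (fun t _ => (hgradc.integral_hasStrictDerivAt 0 t).hasDerivAt)
      (fun t ht => (hgd t).comp_hasDerivAt t (hWd t ht) (Eventually.of_forall hWM)) hanti
    refine ⟨xs, hxs, hlim.congr' ?_, hvar⟩
    filter_upwards [eventually_ge_atTop 0] with t ht
    simp only [hW, max_eq_left ht]
  refine ⟨hquasi, fun hconv => ?_⟩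
  obtain ⟨xs, hxs, hlim, hvar⟩ := hquasi hconv.quasiconvexOn
  refine ⟨xs, subset_closure hxs, hlim, fun x hx => ?_⟩
  rw [hB.isClosed_dom.closure_eq] at hx
  have h1 := hconv.add_inner_le (mem_univ x) (mem_univ xs)
    (hf.differentiable one_ne_zero xs).hasGradientAt
  have h2 := hvar x hx
  exact (le_add_of_nonneg_right h2).trans h1
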